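/- **Theorem (Inverse scattering).** Let $\mathcal H=\ell^2(\mathbb Z;\mathbb C^2)$, let $C_0=\begin{pmatrix} a & b\\ -\bar b & \bar a\end{pmatrix}$ with $a,b\in\mathbb C$, $|a|^2+|b|^2=1$, $0<|a|<1$, and let $C_N:[0,\infty)^2\to U(2)$ be of the form $C_N(s_1,s_2)=\tilde C_N(s_1^2,s_2^2)$, where $\tilde C_N:\mathbb R^2\to U(2)$ is of class $C^2$ and, for some constant $K$, $\|\tilde C_N(s_1,s_2)-I_2\|\le K(|s_1|+|s_2|)$ for all $s_1,s_2\in\mathbb R$. Here $\|\cdot\|$ is the operator norm on $\mathbb C^2$ with its Euclidean norm. Let $S$ be the shift $(Su)(x)=(u_1(x+1),u_2(x-1))^t$. Define operators on $\mathcal H$ by $(U_0u)(x)=(S\,C_0u)(x)$, $(\hat C_Nu)(x)=C_N(|u_1(x)|^2,|u_2(x)|^2)u(x)$ and $U=U_0\hat C_N$, and write $U(t)u_0=U^tu_0$ for the $t$-fold iterate of $U$, $t=0,1,2,\dots$. Put $$W^*u_0=u_0+\sum_{t=0}^\infty U_0^{-t}(\hat C_N-I_2)U(t)u_0 .$$ Let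 $\delta_{j,x}\in\mathcal H$ be equal to the $j$-th standard basis vector $e_j$ of $\mathbb C^2$ at the site $x$ and $0$ elsewhere, let $\langle\cdot,\cdot\rangle$ be the inner product of $\mathcal H$, linear in its first argument, and for $f:(0,\infty)\to\mathbb C$ let $D_\lambda f(\lambda)=\lambda^{-1}(f(2\lambda)-f(\lambda))$. For $j=1,2$ set $$\mathcal L_{1j}(\lambda)=\lambda^{-10}\big\langle (W^*-U_0^{-1}W^*U_0)(\lambda^2\delta_{1,0}+\lambda^3\delta_{2,0}),\delta_{j,0}\big\rangle,$$ $$\mathcal L_{2j}(\lambda)=\lambda^{-10}\big\langle (W^*-U_0^{-1}W^*U_0)(\lambda^3\delta_{1,0}+\lambda^2\delta_{2,0}),\delta_{j,0}\big\rangle .$$ Then there is $\delta>0$ such that the series defining $W^*u_0$ converges (unconditionally) in $\mathcal H$ for every $u_0\in\ell^1(\mathbb Z;\mathbb C^2)$ with $\sum_x\|u_0(x)\|_{\mathbb C^2}<\delta$, and there are $\lambda_0>0$ and a constant $C$, depending only on $C_0$ and $\tilde C_N$, such that for all $0<\lambda<\lambda_0$ $$\left\|\begin{pmatrix}\mathcal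 L_{11}(\lambda)-\lambda D_\lambda\mathcal L_{11}(\lambda)& D_\lambda\mathcal L_{11}(\lambda)\\ \mathcal L_{12}(\lambda)-\lambda D_\lambda\mathcal L_{12}(\lambda)& D_\lambda\mathcal L_{12}(\lambda)\end{pmatrix}-\partial_1\tilde C_N(0,0)\right\|\le C\lambda^3,$$ $$\left\|\begin{pmatrix}D_\lambda\mathcal L_{21}(\lambda)&\mathcal L_{21}(\lambda)-\lambda D_\lambda\mathcal L_{21}(\lambda)\\ D_\lambda\mathcal L_{22}(\lambda)&\mathcal L_{22}(\lambda)-\lambda D_\lambda\mathcal L_{22}(\lambda)\end{pmatrix}-\partial_2\tilde C_N(0,0)\right\|\le C\lambda^3 .$$ -/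

import Mathlib

open scoped Matrix.Norms.L2Operator ComplexConjugate

namespace NLQW

noncomputable section

/-- The spin space `ℂ²` with its Euclidean norm. -/
abbrev Spin : Type := EuclideanSpace ℂ (Fin 2)

/-- The state space `ℋ = ℓ²(ℤ; ℂ²)`. -/
abbrev State : Type := lp (fun _ : ℤ => Spin) 2

/-- The group `U(2)` of unitary `2 × 2` matrices. -/
abbrev U2 : Type := Matrix.unitaryGroup (Fin 2) ℂ

/-- The action `v ↦ M v` of a unitary matrix on `ℂ²`. -/
def act (M : U2) (v : Spin) : Spin := WithLp.toLp 2 ((M : Matrix (Fin 2) (Fin 2) ℂ).mulVec v.ofLp)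

theorem norm_sq_spin (v : Spin) : ‖v‖ ^ 2 = ‖v 0‖ ^ 2 + ‖v 1‖ ^ 2 := by
  rw [EuclideanSpace.norm_sq_eq, Fin.sum_univ_two]

theorem norm_act (M : U2) (v : Spin) : ‖act M v‖ = ‖v‖ := by
  have h : inner ℂ (act M v) (act M v) = inner ℂ v v := by
    have hM : (M : Matrix (Fin 2) (Fin 2) ℂ).conjTranspose * (M : Matrix (Fin 2) (Fin 2) ℂ) = 1 :=
      Matrix.mem_unitaryGroup_iff'.mp M.2
    simp only [act, EuclideanSpace.inner_eq_star_dotProduct]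
    rw [Matrix.star_mulVec, dotProduct_comm, ← Matrix.dotProduct_mulVec, Matrix.mulVec_mulVec, hM,
      Matrix.one_mulVec, dotProduct_comm]
  rw [@norm_eq_sqrt_re_inner ℂ, @norm_eq_sqrt_re_inner ℂ _ _ _ _ v, h]

theorem act_act (M N : U2) (v : Spin) : act M (act N v) = act (M * N) v := by
  simp only [act, Matrix.mulVec_mulVec, Submonoid.coe_mul]

theorem act_add (M : U2) (v w : Spin) : act M (v + w) = act M v + act M w := by
  simp only [act, WithLp.ofLp_add, Matrix.mulVec_add, WithLp.toLp_add]

theorem act_smul (M : U2) (c : ℂ) (v : Spin) : act M (c • v) = c • act M v := by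
  simp only [act, WithLp.ofLp_smul, Matrix.mulVec_smul, WithLp.toLp_smul]

theorem act_one (v : Spin) : act 1 v = v := by
  simp [act]

theorem summable_sq (u : State) : Summable fun x => ‖u x‖ ^ 2 := by
  have h := (memℓp_gen_iff (p := 2) (by norm_num)).1 (lp.memℓp u)
  simpa using h

theorem memlp_of_summable_sq {f : ℤ → Spin} (h : Summable fun x => ‖f x‖ ^ 2) : Memℓp f 2 :=
  (memℓp_gen_iff (p := 2) (by norm_num)).2 (by simpa using h)

theorem norm_sq_state (u : State) : ‖u‖ ^ 2 = ∑' x, ‖u x‖ ^ 2 := by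
  have h := lp.norm_rpow_eq_tsum (p := 2) (by norm_num) u
  simpa using h

/-- The coin operator `(Ĉ u)(x) = C(|u₁(x)|², |u₂(x)|²) u(x)`. -/
def coin (C : ℝ → ℝ → U2) (u : State) : State :=
  ⟨fun x => act (C (‖u x 0‖ ^ 2) (‖u x 1‖ ^ 2)) (u x),
    memlp_of_summable_sq (by simpa only [norm_act] using summable_sq u)⟩

/-- The linear coin operator `(Ĉ₀ u)(x) = C₀ u(x)` as a unitary operator. -/
def linCoin (C₀ : U2) : State ≃ₗᵢ[ℂ] State where
  toFun := coin fun _ _ => C₀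
  invFun := coin fun _ _ => C₀⁻¹
  map_add' u v := by
    refine lp.ext (funext fun x => ?_)
    exact act_add C₀ (u x) (v x)
  map_smul' c u := by
    refine lp.ext (funext fun x => ?_)
    exact act_smul C₀ c (u x)
  left_inv u := by
    ext x i
    simp [coin, act_act, act_one]
  right_inv u := by
    ext x i
    simp [coin, act_act, act_one]
  norm_map' u := by
    have h : ‖coin (fun _ _ => C₀) u‖ ^ 2 = ‖u‖ ^ 2 := by
      rw [norm_sq_state, norm_sq_state]
      simp only [coin, norm_act]
    exact (sq_eq_sq₀ (norm_nonneg _) (norm_nonneg _)).1 h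

theorem summable_comp (u : State) (i : Fin 2) : Summable fun x => ‖u x i‖ ^ 2 := by
  refine (summable_sq u).of_nonneg_of_le (fun x => by positivity) fun x => ?_
  rw [norm_sq_spin]
  fin_cases i
  · exact le_add_of_nonneg_right (by positivity)
  · exact le_add_of_nonneg_left (by positivity)

/-- The map `u ↦ (x ↦ (u₁(x + n), u₂(x - n)))`. -/
def shiftFun (n : ℤ) (u : State) : State :=
  ⟨fun x => !₂[u (x + n) 0, u (x - n) 1], memlp_of_summable_sq (by
    simp only [norm_sq_spin]
    exact ((Equiv.addRight n).summable_iff.2 (summable_comp u 0)).add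
      ((Equiv.subRight n).summable_iff.2 (summable_comp u 1)))⟩

/-- The shift `S = diag(T₋, T₊)`, where `(T_± u)(x) = u(x ∓ 1)`:
`(S u)(x) = (u₁(x + 1), u₂(x - 1))`. -/
def shift : State ≃ₗᵢ[ℂ] State where
  toFun := shiftFun 1
  invFun := shiftFun (-1)
  map_add' u v := by
    ext x i
    fin_cases i <;> rfl
  map_smul' c u := by
    ext x i
    fin_cases i <;> simp [shiftFun]
  left_inv u := by
    ext x i
    fin_cases i <;> simp [shiftFun]
  right_inv u := by
    ext x i
    fin_cases i <;> simp [shiftFun]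
  norm_map' u := by
    have h : ‖shiftFun 1 u‖ ^ 2 = ‖u‖ ^ 2 := by
      rw [norm_sq_state, norm_sq_state]
      simp only [norm_sq_spin]
      rw [(summable_comp u 0).tsum_add (summable_comp u 1),
        ← (Equiv.addRight (1 : ℤ)).tsum_eq fun x => ‖u x 0‖ ^ 2,
        ← (Equiv.subRight (1 : ℤ)).tsum_eq fun x => ‖u x 1‖ ^ 2]
      exact ((Equiv.addRight (1 : ℤ)).summable_iff.2 (summable_comp u 0)).tsum_add
        ((Equiv.subRight (1 : ℤ)).summable_iff.2 (summable_comp u 1))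
    exact (sq_eq_sq₀ (norm_nonneg _) (norm_nonneg _)).1 h

/-- The linear walk `U₀ = S Ĉ₀`. -/
def U0 (C₀ : U2) : State ≃ₗᵢ[ℂ] State := shift * linCoin C₀

/-- One step `U = S Ĉ` of the nonlinear walk with coin `C(s₁, s₂) = C₀ C_N(s₁, s₂)`. -/
def step (C₀ : U2) (CN : ℝ → ℝ → U2) (u : State) : State :=
  shift (coin (fun s₁ s₂ => C₀ * CN s₁ s₂) u)

/-- The nonlinear evolution `U(t) u₀`. -/
def evol (C₀ : U2) (CN : ℝ → ℝ → U2) (t : ℕ) (u₀ : State) : State := (step C₀ CN)^[t] u₀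

/-- The terms `U₀^{-t} (Ĉ_N - I₂) U(t) u₀` of the series defining `W^*`. -/
def waveTerm (C₀ : U2) (CN : ℝ → ℝ → U2) (u₀ : State) (t : ℕ) : State :=
  ((U0 C₀)⁻¹ ^ t) (coin CN (evol C₀ CN t u₀) - evol C₀ CN t u₀)

/-- `W^* u₀ = u₀ + ∑_{t ≥ 0} U₀^{-t} (Ĉ_N - I₂) U(t) u₀`, the sum being taken in `ℋ`. -/
def Wstar (C₀ : U2) (CN : ℝ → ℝ → U2) (u₀ : State) : State :=
  u₀ + ∑' t : ℕ, waveTerm C₀ CN u₀ t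

/-- `δ_{j,x}`: the value `e_j` at `x` and `0` elsewhere. -/
def delta (j : Fin 2) (x : ℤ) : State := lp.single 2 x (EuclideanSpace.single j (1 : ℂ))

/-- The input states, with indices `1, 2` written as `0, 1`:
`λ² δ_{1,0} + λ³ δ_{2,0}` for `i = 0` and `λ³ δ_{1,0} + λ² δ_{2,0}` for `i = 1`. -/
def datum (i : Fin 2) (l : ℝ) : State :=
  (l : ℂ) ^ 2 • delta i 0 + (l : ℂ) ^ 3 • delta (1 - i) 0

/-- `𝓛_{ij}(λ) = λ^{-10} ⟨(W^* - U₀^{-1} W^* U₀) φ_i(λ), δ_{j,0}⟩`, with `φ_i(λ) = datum i λ`.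
Mathlib's inner product is linear in its second argument. -/
def scatL (C₀ : U2) (CN : ℝ → ℝ → U2) (i j : Fin 2) (l : ℝ) : ℂ :=
  ((l : ℂ) ^ 10)⁻¹ * inner ℂ (delta j 0)
    (Wstar C₀ CN (datum i l) - (U0 C₀)⁻¹ (Wstar C₀ CN (U0 C₀ (datum i l))))

/-- The difference quotient `(D_λ f)(λ) = λ⁻¹ (f(2λ) - f(λ))`. -/
def diffQuot (f : ℝ → ℂ) (l : ℝ) : ℂ := (l : ℂ)⁻¹ * (f (2 * l) - f l)

/-- The matrix built from `𝓛_{11}, 𝓛_{12}` that approximates `∂₁ C̃_N(0,0)`; here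
`L i j` stands for `𝓛_{i+1, j+1}`. -/
def recon₁ (L : Fin 2 → Fin 2 → ℝ → ℂ) (l : ℝ) : Matrix (Fin 2) (Fin 2) ℂ :=
  !![L 0 0 l - l * diffQuot (L 0 0) l, diffQuot (L 0 0) l;
     L 0 1 l - l * diffQuot (L 0 1) l, diffQuot (L 0 1) l]

/-- The matrix built from `𝓛_{21}, 𝓛_{22}` that approximates `∂₂ C̃_N(0,0)`. -/
def recon₂ (L : Fin 2 → Fin 2 → ℝ → ℂ) (l : ℝ) : Matrix (Fin 2) (Fin 2) ℂ :=
  !![diffQuot (L 1 0) l, L 1 0 l - l * diffQuot (L 1 0) l;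
     diffQuot (L 1 1) l, L 1 1 l - l * diffQuot (L 1 1) l]

end

end NLQW

/-! The nonlinear part of the coin, `N(v) = (C_N - 1)v`, is quintic: the coin sees `|v_j|²`, `C_N`
squares its arguments, and `C̃_N - 1` vanishes linearly at the origin. For data of `ℓ¹` size `ε` it
is therefore a perturbation of size `ε⁵`, provided that the linear walk disperses fast enough.

Dispersion. `U₀` satisfies a Cayley–Hamilton identity whose coefficients are scalar translations, so
`U₀^{t+1} = q_{t+1} * U₀ - q_t *` with kernels of Chebyshev type. On the Fourier side these are
`sin(kθ)/sin θ`, where `cos θ = r cos ξ` and `r = |a|`. At the zeros of `cos ξ` the derivative `θ''`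
vanishes but `θ'` still has increments of quadratic size, so an estimate of van der Corput type
gives `ℓ¹ → ℓ^∞` decay `(1+t)^{-1/3}` (`exists_norm_U0_pow_apply_le`). Interpolation with the
conservation of the `ℓ²` norm gives decay `(1+t)^{-2/9}` in `ℓ⁶`, both from `ℓ¹` and from `ℓ^{6/5}`
(`exists_n6_U0_pow_le`). A quintic term maps `ℓ⁶` to `ℓ^{6/5}`, and `5 · 2/9 > 1`, so Duhamel's
formula closes by induction (`n6_evol_le`) and the series for `W^*` converges absolutely.

Scattering data. Replacing `U(t)u` by `U₀^t u` inside `N` costs `O(ε⁴ · ε⁵) = O(ε⁹)`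
(`exists_wave_bounds`). For the linearised series `V(u) = ∑ U₀^{-t} N(U₀^t u)` the difference `V(u)
- U₀⁻¹ V(U₀ u)` telescopes to its first term `N(u)`; hence `(W^* - U₀⁻¹ W^* U₀)u = N(u) + O(ε⁹)`
(`exists_norm_Wstar_sub_le`).

Reconstruction. With `A_i = ∂_i C̃_N(0,0)`, Taylor expansion at the datum gives `λ^{10}(A_i e_i + λ
A_i e_{i'}) + O(λ^{14})`, where `i'` is the other index, while `ε⁹` is of order `λ^{18}`. Thus
`𝓛_{ij}` is affine in `λ` up to `O(λ⁴)`, its intercept and slope are entries of `A_i`, and `D_λ`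
separates the two with error `O(λ³)`. -/

namespace NLQW

noncomputable section

/-! ### Oscillatory integrals -/

open MeasureTheory intervalIntegral in
/-- First derivative test for oscillatory integrals, with convex phase and an amplitude. -/
theorem norm_integral_osc_le_of_le_abs_deriv {φ φ₁ φ₂ g g₁ : ℝ → ℝ} {A B m G G₁ : ℝ} (hAB : A ≤ B)
    (hφ : ∀ x, HasDerivAt φ (φ₁ x) x) (hφ₁ : ∀ x, HasDerivAt φ₁ (φ₂ x) x) (hφ₂ : Continuous φ₂)
    (hg : ∀ x, HasDerivAt g (g₁ x) x) (hg₁ : Continuous g₁) (hm : 0 < m)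
    (hconv : ∀ x ∈ Set.Icc A B, 0 ≤ φ₂ x) (hlow : ∀ x ∈ Set.Icc A B, m ≤ |φ₁ x|)
    (hG : ∀ x, |g x| ≤ G) (hG₁ : ∀ x, |g₁ x| ≤ G₁) :
    ‖∫ x in A..B, Complex.exp (φ x * Complex.I) * g x‖ ≤ (4 * G + G₁ * (B - A)) / m := by
  have cφ : Continuous φ := continuous_iff_continuousAt.2 fun x => (hφ x).continuousAt
  have cφ₁ : Continuous φ₁ := continuous_iff_continuousAt.2 fun x => (hφ₁ x).continuousAt
  have cg : Continuous g := continuous_iff_continuousAt.2 fun x => (hg x).continuousAt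
  have hG0 : 0 ≤ G := (abs_nonneg _).trans (hG A)
  have hne : ∀ x ∈ Set.Icc A B, φ₁ x ≠ 0 := fun x hx h => by
    have := hlow x hx
    rw [h, abs_zero] at this
    linarith
  have hneC : ∀ x ∈ Set.Icc A B, (φ₁ x : ℂ) ≠ 0 := fun x hx => by
    exact_mod_cast hne x hx
  set h : ℝ → ℝ := fun x => g₁ x / φ₁ x - g x * φ₂ x / φ₁ x ^ 2 with hh
  have ch : ContinuousOn h (Set.Icc A B) := by
    refine ContinuousOn.sub (hg₁.continuousOn.div cφ₁.continuousOn hne) ?_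
    exact (cg.mul hφ₂).continuousOn.div (cφ₁.pow 2).continuousOn
      fun x hx => pow_ne_zero 2 (hne x hx)
  -- Integration by parts: `F` is `e^{iφ} g / (iφ₁)`, and `h` is the derivative of `g / φ₁`.
  set F : ℝ → ℂ := fun x => Complex.exp (φ x * Complex.I) * (g x / φ₁ x : ℝ) / Complex.I with hF
  have hFd : ∀ x ∈ Set.uIcc A B, HasDerivAt F (Complex.exp (φ x * Complex.I) * g x +
      Complex.exp (φ x * Complex.I) * (h x) / Complex.I) x := by
    intro x hx
    rw [Set.uIcc_of_le hAB] at hx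
    have h1 : HasDerivAt (fun x => Complex.exp (φ x * Complex.I))
        (Complex.exp (φ x * Complex.I) * (φ₁ x * Complex.I)) x :=
      ((hφ x).ofReal_comp.mul_const Complex.I).cexp
    have h2 : HasDerivAt (fun x => g x / φ₁ x) (h x) x := by
      refine ((hg x).div (hφ₁ x) (hne x hx)).congr_deriv ?_
      simp only [hh]
      have := hne x hx
      field_simp
    refine ((h1.mul h2.ofReal_comp).div_const Complex.I).congr_deriv ?_
    have := hneC x hx
    push_cast
    field_simp
  have ce : Continuous fun x => Complex.exp (φ x * Complex.I) :=
    Complex.continuous_exp.comp ((Complex.continuous_ofReal.comp cφ).mul continuous_const)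
  have i1 : IntervalIntegrable (fun x => Complex.exp (φ x * Complex.I) * g x) volume A B :=
    (ce.mul (Complex.continuous_ofReal.comp cg)).intervalIntegrable _ _
  have i2 : IntervalIntegrable (fun x => Complex.exp (φ x * Complex.I) * (h x) / Complex.I)
      volume A B := by
    apply ContinuousOn.intervalIntegrable_of_Icc hAB
    exact (ce.continuousOn.mul (Complex.continuous_ofReal.comp_continuousOn ch)).div_const _
  have key := integral_eq_sub_of_hasDerivAt hFd (i1.add i2)
  rw [integral_add i1 i2] at key
  have hFb : ∀ x ∈ Set.Icc A B, ‖F x‖ ≤ G / m := fun x hx => by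
    simp only [hF, norm_div, norm_mul, Complex.norm_exp_ofReal_mul_I, Complex.norm_I, one_mul,
      div_one, Complex.norm_real, Real.norm_eq_abs]
    exact div_le_div₀ hG0 (hG x) hm (hlow x hx)
  have hinv : ∀ x ∈ Set.Icc A B, |(φ₁ x)⁻¹| ≤ m⁻¹ := fun x hx => by
    rw [abs_inv]
    exact inv_anti₀ hm (hlow x hx)
  have i3 : IntervalIntegrable (fun x => φ₂ x / φ₁ x ^ 2) volume A B := by
    apply ContinuousOn.intervalIntegrable_of_Icc hAB
    exact hφ₂.continuousOn.div (cφ₁.pow 2).continuousOn fun x hx => pow_ne_zero 2 (hne x hx)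
  -- Convexity enters here: `φ₂ / φ₁²` is nonnegative and is the derivative of `-1/φ₁`, so its
  -- integral is at most `2 / m` whatever the length of the interval.
  have hint : ∫ x in A..B, φ₂ x / φ₁ x ^ 2 ≤ 2 / m := by
    have hd : ∀ x ∈ Set.uIcc A B, HasDerivAt (fun x => -(φ₁ x)⁻¹) (φ₂ x / φ₁ x ^ 2) x := by
      intro x hx
      rw [Set.uIcc_of_le hAB] at hx
      refine ((hφ₁ x).inv (hne x hx)).neg.congr_deriv ?_
      ring
    rw [integral_eq_sub_of_hasDerivAt hd i3]
    have h1 := (abs_le.1 (hinv A ⟨le_rfl, hAB⟩)).2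
    have h2 := (abs_le.1 (hinv B ⟨hAB, le_rfl⟩)).1
    rw [div_eq_mul_inv]
    linarith
  have hrem : ‖∫ x in A..B, Complex.exp (φ x * Complex.I) * (h x) / Complex.I‖
      ≤ G₁ * (B - A) / m + G * (2 / m) := by
    have hb : ∀ x ∈ Set.Ioc A B, ‖Complex.exp (φ x * Complex.I) * (h x) / Complex.I‖
        ≤ G₁ / m + G * (φ₂ x / φ₁ x ^ 2) := by
      intro x hx
      have hx := Set.Ioc_subset_Icc_self hx
      simp only [norm_div, norm_mul, Complex.norm_exp_ofReal_mul_I, Complex.norm_I, one_mul,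
        div_one, Complex.norm_real, Real.norm_eq_abs]
      refine (abs_sub _ _).trans (add_le_add ?_ ?_)
      · rw [abs_div]
        exact div_le_div₀ ((abs_nonneg _).trans (hG₁ x)) (hG₁ x) hm (hlow x hx)
      · rw [mul_div_assoc, abs_mul, abs_of_nonneg (div_nonneg (hconv x hx) (sq_nonneg (φ₁ x)))]
        exact mul_le_mul_of_nonneg_right (hG x) (div_nonneg (hconv x hx) (sq_nonneg _))
    have i4 : IntervalIntegrable (fun x => G₁ / m + G * (φ₂ x / φ₁ x ^ 2)) volume A B :=
      intervalIntegrable_const.add (i3.const_mul G)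
    refine (norm_integral_le_of_norm_le hAB (Filter.Eventually.of_forall hb) i4).trans ?_
    rw [integral_add intervalIntegrable_const (i3.const_mul G), intervalIntegral.integral_const,
      intervalIntegral.integral_const_mul, smul_eq_mul]
    have := mul_le_mul_of_nonneg_left hint hG0
    have e : (B - A) * (G₁ / m) = G₁ * (B - A) / m := by ring
    linarith
  have e : ∫ x in A..B, Complex.exp (φ x * Complex.I) * g x
      = F B - F A - ∫ x in A..B, Complex.exp (φ x * Complex.I) * (h x) / Complex.I := by
    rw [← key]; ring
  rw [e]
  refine (norm_sub_le _ _).trans ((add_le_add (norm_sub_le _ _) hrem).trans ?_)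
  have h1 := hFb A ⟨le_rfl, hAB⟩
  have h2 := hFb B ⟨hAB, le_rfl⟩
  have e : (4 * G + G₁ * (B - A)) / m = G / m + G / m + (G₁ * (B - A) / m + G * (2 / m)) := by
    ring
  linarith

open MeasureTheory intervalIntegral in
/-- An oscillatory integral whose phase has a derivative growing at least quadratically is bounded
by splitting off the set where that derivative is smaller than `m`. -/
theorem norm_integral_osc_le {φ φ₁ φ₂ g g₁ : ℝ → ℝ} {A B m κ G G₁ : ℝ} (hAB : A ≤ B)
    (hφ : ∀ x, HasDerivAt φ (φ₁ x) x) (hφ₁ : ∀ x, HasDerivAt φ₁ (φ₂ x) x) (hφ₂ : Continuous φ₂)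
    (hg : ∀ x, HasDerivAt g (g₁ x) x) (hg₁ : Continuous g₁) (hm : 0 < m) (hκ : 0 < κ)
    (hconv : ∀ x ∈ Set.Icc A B, 0 ≤ φ₂ x)
    (hgrow : ∀ x ∈ Set.Icc A B, ∀ y ∈ Set.Icc A B, x ≤ y → κ * (y - x) ^ 2 ≤ φ₁ y - φ₁ x)
    (hG : ∀ x, |g x| ≤ G) (hG₁ : ∀ x, |g₁ x| ≤ G₁) :
    ‖∫ x in A..B, Complex.exp (φ x * Complex.I) * g x‖
      ≤ 2 * ((4 * G + G₁ * (B - A)) / m) + G * √(2 * m / κ) := by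
  have cφ : Continuous φ := continuous_iff_continuousAt.2 fun x => (hφ x).continuousAt
  have cφ₁ : Continuous φ₁ := continuous_iff_continuousAt.2 fun x => (hφ₁ x).continuousAt
  have cg : Continuous g := continuous_iff_continuousAt.2 fun x => (hg x).continuousAt
  have hG0 : 0 ≤ G := (abs_nonneg _).trans (hG A)
  have hG10 : 0 ≤ G₁ := (abs_nonneg _).trans (hG₁ A)
  set f : ℝ → ℂ := fun x => Complex.exp (φ x * Complex.I) * g x with hf
  have cf : Continuous f := (Complex.continuous_exp.comp
    ((Complex.continuous_ofReal.comp cφ).mul continuous_const)).mul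
    (Complex.continuous_ofReal.comp cg)
  have mono : ∀ x ∈ Set.Icc A B, ∀ y ∈ Set.Icc A B, x ≤ y → φ₁ x ≤ φ₁ y := fun x hx y hy h => by
    have := hgrow x hx y hy h
    have := mul_nonneg hκ.le (sq_nonneg (y - x))
    linarith
  have bd : ∀ A' B', A ≤ A' → A' ≤ B' → B' ≤ B → (∀ x ∈ Set.Icc A' B', m ≤ |φ₁ x|) →
      ‖∫ x in A'..B', f x‖ ≤ (4 * G + G₁ * (B - A)) / m := by
    intro A' B' h1 h2 h3 h4
    refine (norm_integral_osc_le_of_le_abs_deriv h2 hφ hφ₁ hφ₂ hg hg₁ hm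
      (fun x hx => hconv x ⟨h1.trans hx.1, hx.2.trans h3⟩) h4 hG hG₁).trans ?_
    gcongr
  have hpos : 0 ≤ (4 * G + G₁ * (B - A)) / m :=
    div_nonneg (add_nonneg (by linarith) (mul_nonneg hG10 (by linarith))) hm.le
  -- Since `φ₁` is monotone, `α` is where it crosses `-m`, or an endpoint if there is no crossing.
  -- The strict `α < x` is needed for `α = B`, where `φ₁ α` may lie below `-m`.
  obtain ⟨α, hα, hα1, hα2⟩ : ∃ α ∈ Set.Icc A B, ‖∫ x in A..α, f x‖
      ≤ (4 * G + G₁ * (B - A)) / m ∧ ∀ x ∈ Set.Icc α B, α < x → -m ≤ φ₁ x := by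
    by_cases h1 : -m ≤ φ₁ A
    · exact ⟨A, ⟨le_rfl, hAB⟩, by simpa using hpos, fun x hx _ =>
        h1.trans (mono A ⟨le_rfl, hAB⟩ x hx hx.1)⟩
    by_cases h2 : φ₁ B ≤ -m
    · refine ⟨B, ⟨hAB, le_rfl⟩, bd A B le_rfl hAB le_rfl fun x hx => ?_, fun x hx h =>
        absurd hx.2 (not_le.2 h)⟩
      rw [le_abs]
      have := mono x hx B ⟨hAB, le_rfl⟩ hx.2
      exact Or.inr (by linarith)
    push Not at h1 h2
    obtain ⟨α, hα, e⟩ := intermediate_value_Icc hAB cφ₁.continuousOn ⟨h1.le, h2.le⟩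
    refine ⟨α, hα, bd A α le_rfl hα.1 hα.2 fun x hx => ?_, fun x hx _ => ?_⟩
    · rw [le_abs]
      have := mono x ⟨hx.1, hx.2.trans hα.2⟩ α hα hx.2
      exact Or.inr (by linarith)
    · have := mono α hα x ⟨hα.1.trans hx.1, hx.2⟩ hx.1
      linarith
  obtain ⟨β, hβ, hβ1, hβ2⟩ : ∃ β ∈ Set.Icc α B, ‖∫ x in β..B, f x‖
      ≤ (4 * G + G₁ * (B - A)) / m ∧ ∀ x ∈ Set.Icc α β, x < β → φ₁ x ≤ m := by
    have hBm : B ∈ Set.Icc A B := ⟨hAB, le_rfl⟩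
    by_cases h1 : φ₁ B ≤ m
    · exact ⟨B, ⟨hα.2, le_rfl⟩, by simpa using hpos, fun x hx _ =>
        (mono x ⟨hα.1.trans hx.1, hx.2⟩ B hBm hx.2).trans h1⟩
    by_cases h2 : m ≤ φ₁ α
    · refine ⟨α, ⟨le_rfl, hα.2⟩, bd α B hα.1 hα.2 le_rfl fun x hx => ?_, fun x hx h =>
        absurd hx.1 (not_le.2 h)⟩
      rw [le_abs]
      have := mono α hα x ⟨hα.1.trans hx.1, hx.2⟩ hx.1
      exact Or.inl (by linarith)
    push Not at h1 h2
    obtain ⟨β, hβ, e⟩ := intermediate_value_Icc hα.2 cφ₁.continuousOn ⟨h2.le, h1.le⟩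
    have hβ' : β ∈ Set.Icc A B := ⟨hα.1.trans hβ.1, hβ.2⟩
    refine ⟨β, hβ, bd β B hβ'.1 hβ.2 le_rfl fun x hx => ?_, fun x hx _ => ?_⟩
    · rw [le_abs]
      have := mono β hβ' x ⟨hβ'.1.trans hx.1, hx.2⟩ hx.1
      exact Or.inl (by linarith)
    · have := mono x ⟨hα.1.trans hx.1, hx.2.trans hβ.2⟩ β hβ' hx.2
      linarith
  -- Strictly between `α` and `β` the derivative stays in `[-m, m]`, so quadratic growth gives `κ (y
  -- - x)² ≤ 2m` there; the endpoints are reached by a limit.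
  have hlen : β - α ≤ √(2 * m / κ) := by
    rcases hβ.1.eq_or_lt with h | h
    · rw [h, sub_self]; exact Real.sqrt_nonneg _
    have hl : ∀ x ∈ Set.Ioo α β, ∀ y ∈ Set.Ioo α β, x ≤ y → y - x ≤ √(2 * m / κ) := by
      intro x hx y hy hxy
      apply Real.le_sqrt_of_sq_le
      rw [le_div_iff₀ hκ]
      have h1 := hgrow x ⟨hα.1.trans hx.1.le, hx.2.le.trans hβ.2⟩ y
        ⟨hα.1.trans hy.1.le, hy.2.le.trans hβ.2⟩ hxy
      have h2 := hα2 x ⟨hx.1.le, hx.2.le.trans hβ.2⟩ hx.1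
      have h3 := hβ2 y ⟨hy.1.le, hy.2.le⟩ hy.2
      linarith
    refine le_of_forall_pos_lt_add fun ε hε => ?_
    have h5 : 0 < min (ε / 4) ((β - α) / 4) := lt_min (by linarith) (by linarith)
    have h6 := min_le_left (ε / 4) ((β - α) / 4)
    have h7 := min_le_right (ε / 4) ((β - α) / 4)
    have := hl (α + min (ε / 4) ((β - α) / 4)) ⟨by linarith, by linarith⟩
      (β - min (ε / 4) ((β - α) / 4)) ⟨by linarith, by linarith⟩ (by linarith)
    linarith
  have hmid : ‖∫ x in α..β, f x‖ ≤ G * √(2 * m / κ) := by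
    have := norm_integral_le_of_norm_le_const (a := α) (b := β) (f := f) (C := G) fun x _ => by
      simpa [hf, Complex.norm_exp_ofReal_mul_I] using hG x
    rw [abs_of_nonneg (by linarith [hβ.1])] at this
    exact this.trans (mul_le_mul_of_nonneg_left hlen hG0)
  have i : ∀ s t, IntervalIntegrable f volume s t := fun s t => cf.intervalIntegrable _ _
  rw [← integral_add_adjacent_intervals (i A α) (i α B),
    ← integral_add_adjacent_intervals (i α β) (i β B)]
  refine (norm_add_le _ _).trans ?_
  have := norm_add_le (∫ x in α..β, f x) (∫ x in β..B, f x)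
  linarith

/-! ### The dispersion relation and its inflection points -/

/-- The dispersion relation `cos θ = r cos ξ` of the walk. -/
def disp (r ξ : ℝ) : ℝ := Real.arccos (r * Real.cos ξ)

/-- `1 - r² cos² ξ = sin² θ`. -/
def dispSq (r ξ : ℝ) : ℝ := 1 - (r * Real.cos ξ) ^ 2

section

variable {r : ℝ}

theorem one_sub_sq_le_dispSq (ξ : ℝ) : 1 - r ^ 2 ≤ dispSq r ξ := by
  unfold dispSq
  have := Real.cos_sq_le_one ξ
  nlinarith [sq_nonneg r]

theorem dispSq_le_one (ξ : ℝ) : dispSq r ξ ≤ 1 := by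
  unfold dispSq
  nlinarith [sq_nonneg (r * Real.cos ξ)]

theorem dispSq_pos (h0 : 0 < r) (h1 : r < 1) (ξ : ℝ) : 0 < dispSq r ξ :=
  lt_of_lt_of_le (by nlinarith) (one_sub_sq_le_dispSq ξ)

theorem sin_disp (ξ : ℝ) : Real.sin (disp r ξ) = √(dispSq r ξ) := by
  rw [disp, Real.sin_arccos, dispSq]

theorem abs_mul_cos_lt_one (h0 : 0 < r) (h1 : r < 1) (ξ : ℝ) : |r * Real.cos ξ| < 1 := by
  rw [abs_mul, abs_of_pos h0]
  have := Real.abs_cos_le_one ξ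
  nlinarith [abs_nonneg (Real.cos ξ)]

theorem cos_disp (h0 : 0 < r) (h1 : r < 1) (ξ : ℝ) : Real.cos (disp r ξ) = r * Real.cos ξ := by
  have h := abs_lt.1 (abs_mul_cos_lt_one h0 h1 ξ)
  exact Real.cos_arccos h.1.le h.2.le

theorem hasDerivAt_dispSq (ξ : ℝ) :
    HasDerivAt (dispSq r) (2 * r ^ 2 * Real.cos ξ * Real.sin ξ) ξ := by
  have := (((Real.hasDerivAt_cos ξ).const_mul r).pow 2).const_sub 1
  refine this.congr_deriv ?_
  ring

theorem hasDerivAt_sqrt_dispSq (h0 : 0 < r) (h1 : r < 1) (ξ : ℝ) :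
    HasDerivAt (fun ξ => √(dispSq r ξ)) (r ^ 2 * Real.cos ξ * Real.sin ξ / √(dispSq r ξ)) ξ := by
  have := (hasDerivAt_dispSq ξ).sqrt (dispSq_pos h0 h1 ξ).ne'
  refine this.congr_deriv ?_
  have := (Real.sqrt_pos.2 (dispSq_pos h0 h1 ξ)).ne'
  field_simp

theorem hasDerivAt_disp (h0 : 0 < r) (h1 : r < 1) (ξ : ℝ) :
    HasDerivAt (disp r) (r * Real.sin ξ / √(dispSq r ξ)) ξ := by
  have h := abs_lt.1 (abs_mul_cos_lt_one h0 h1 ξ)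
  have := (Real.hasDerivAt_arccos h.1.ne' h.2.ne).comp ξ ((Real.hasDerivAt_cos ξ).const_mul r)
  refine this.congr_deriv ?_
  simp only [dispSq]
  ring

theorem hasDerivAt_inv_sqrt_dispSq (h0 : 0 < r) (h1 : r < 1) (ξ : ℝ) :
    HasDerivAt (fun ξ => (√(dispSq r ξ))⁻¹)
      (-(r ^ 2 * Real.cos ξ * Real.sin ξ / √(dispSq r ξ)) / √(dispSq r ξ) ^ 2) ξ :=
  (hasDerivAt_sqrt_dispSq h0 h1 ξ).inv (Real.sqrt_pos.2 (dispSq_pos h0 h1 ξ)).ne'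

theorem hasDerivAt_deriv_disp (h0 : 0 < r) (h1 : r < 1) (ξ : ℝ) :
    HasDerivAt (fun ξ => r * Real.sin ξ / √(dispSq r ξ))
      (r * (1 - r ^ 2) * Real.cos ξ / √(dispSq r ξ) ^ 3) ξ := by
  have hp := Real.sqrt_pos.2 (dispSq_pos h0 h1 ξ)
  have := ((Real.hasDerivAt_sin ξ).const_mul r).div (hasDerivAt_sqrt_dispSq h0 h1 ξ) hp.ne'
  refine this.congr_deriv ?_
  have hs : √(dispSq r ξ) ^ 2 = 1 - (r * Real.cos ξ) ^ 2 := Real.sq_sqrt (dispSq_pos h0 h1 ξ).le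
  have hsc := Real.sin_sq_add_cos_sq ξ
  have e : Real.sin ξ ^ 2 = 1 - Real.cos ξ ^ 2 := by linarith
  field_simp
  rw [hs, e]
  ring

theorem continuous_dispSq : Continuous (dispSq r) := by
  unfold dispSq
  fun_prop

/-- Among intervals of a given length, the sine increases least on those touching `±π/2`, where its
increment is exactly `1 - cos` of the length. The product formulas reduce this to comparing `cos ((y
+ x)/2)` with `sin ((y - x)/2)`. -/
theorem one_sub_cos_le_sin_sub_sin {x y : ℝ} (hx : -(Real.pi / 2) ≤ x) (hxy : x ≤ y)
    (hy : y ≤ Real.pi / 2) : 1 - Real.cos (y - x) ≤ Real.sin y - Real.sin x := by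
  have e1 : Real.sin y - Real.sin x = 2 * Real.sin ((y - x) / 2) * Real.cos ((y + x) / 2) :=
    Real.sin_sub_sin y x
  have e2 : 1 - Real.cos (y - x) = 2 * Real.sin ((y - x) / 2) * Real.sin ((y - x) / 2) := by
    have h1 := Real.cos_sq ((y - x) / 2)
    have h2 := Real.sin_sq_add_cos_sq ((y - x) / 2)
    have h3 : 2 * ((y - x) / 2) = y - x := by ring
    rw [h3] at h1
    nlinarith
  have hs : 0 ≤ Real.sin ((y - x) / 2) :=
    Real.sin_nonneg_of_nonneg_of_le_pi (by linarith) (by linarith [Real.pi_pos])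
  rw [e1, e2]
  refine mul_le_mul_of_nonneg_left ?_ (by linarith)
  rw [← Real.cos_pi_div_two_sub, ← Real.cos_abs ((y + x) / 2)]
  refine Real.cos_le_cos_of_nonneg_of_le_pi (abs_nonneg _) (by linarith [Real.pi_pos]) ?_
  exact abs_le.2 ⟨by linarith, by linarith⟩

/-- Because `sin θ ≤ 1`, `θ'' = r(1 - r²) cos ξ / sin³ θ` dominates the derivative of `r(1 - r²) sin
ξ`, and the sine has increments of at least quadratic size on this interval, even at its ends, where
`θ''` vanishes. -/
theorem deriv_disp_growth (h0 : 0 < r) (h1 : r < 1) {x y : ℝ}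
    (hx : x ∈ Set.Icc (-(Real.pi / 2)) (Real.pi / 2))
    (hy : y ∈ Set.Icc (-(Real.pi / 2)) (Real.pi / 2)) (hxy : x ≤ y) :
    r * (1 - r ^ 2) * (2 / Real.pi ^ 2) * (y - x) ^ 2
      ≤ r * Real.sin y / √(dispSq r y) - r * Real.sin x / √(dispSq r x) := by
  have hc : 0 < r * (1 - r ^ 2) := mul_pos h0 (by nlinarith)
  have hm : MonotoneOn (fun ξ => r * Real.sin ξ / √(dispSq r ξ) - r * (1 - r ^ 2) * Real.sin ξ)
      (Set.Icc (-(Real.pi / 2)) (Real.pi / 2)) := by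
    have hd := fun ξ => (hasDerivAt_deriv_disp h0 h1 ξ).sub
      ((Real.hasDerivAt_sin ξ).const_mul (r * (1 - r ^ 2)))
    refine monotoneOn_of_deriv_nonneg (convex_Icc _ _)
      (fun ξ _ => (hd ξ).continuousAt.continuousWithinAt)
      (fun ξ _ => (hd ξ).differentiableAt.differentiableWithinAt) fun ξ hξ => ?_
    rw [interior_Icc] at hξ
    have e := (hd ξ).deriv
    simp only [Pi.sub_def] at e
    rw [e]
    have hcos := (Real.cos_pos_of_mem_Ioo hξ).le
    have hp := Real.sqrt_pos.2 (dispSq_pos h0 h1 ξ)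
    have hle : √(dispSq r ξ) ^ 3 ≤ 1 := pow_le_one₀ hp.le (Real.sqrt_le_one.2 (dispSq_le_one ξ))
    rw [sub_nonneg, le_div_iff₀ (by positivity)]
    exact mul_le_of_le_one_right (mul_nonneg hc.le hcos) hle
  have hm := hm hx hy hxy
  have h2 := one_sub_cos_le_sin_sub_sin hx.1 hxy hy.2
  have h3 : Real.cos (y - x) ≤ 1 - 2 / Real.pi ^ 2 * (y - x) ^ 2 := by
    apply Real.cos_le_one_sub_mul_cos_sq
    rw [abs_of_nonneg (by linarith)]
    linarith [hx.1, hy.2]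
  have h4 : 2 / Real.pi ^ 2 * (y - x) ^ 2 ≤ Real.sin y - Real.sin x := by linarith
  have := mul_le_mul_of_nonneg_left h4 hc.le
  simp only at hm
  linarith

/-- The linear term `zξ` does not affect `φ₂` or the increments of `φ₁`, which makes the bound
uniform in `z`. -/
theorem exists_norm_integral_disp_le (h0 : 0 < r) (h1 : r < 1) :
    ∃ C : ℝ, 0 < C ∧ ∀ n : ℕ, 0 < n → ∀ z : ℝ,
      ‖∫ ξ in (-(Real.pi / 2))..(Real.pi / 2),
        Complex.exp ((n * disp r ξ + z * ξ : ℝ) * Complex.I) * ((√(dispSq r ξ))⁻¹ : ℝ)‖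
        ≤ C * (n : ℝ) ^ (-(1 / 3) : ℝ) := by
  set ρ := √(1 - r ^ 2) with hρ
  have hρ0 : 0 < ρ := Real.sqrt_pos.2 (by nlinarith)
  have hDl : ∀ ξ, ρ ≤ √(dispSq r ξ) := fun ξ => Real.sqrt_le_sqrt (one_sub_sq_le_dispSq ξ)
  set κ := r * (1 - r ^ 2) * (2 / Real.pi ^ 2) with hκ
  have hκ0 : 0 < κ := mul_pos (mul_pos h0 (by nlinarith)) (by positivity)
  set G := ρ⁻¹ with hG
  set G₁ := 1 / ρ ^ 3 with hG₁
  have cD : Continuous fun ξ => √(dispSq r ξ) := continuous_dispSq.sqrt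
  have hDne : ∀ ξ, √(dispSq r ξ) ≠ 0 := fun ξ => (hρ0.trans_le (hDl ξ)).ne'
  refine ⟨2 * (4 * G + G₁ * Real.pi) + G * √(2 / κ), by positivity, fun n hn z => ?_⟩
  have hn' : (0 : ℝ) < n := by exact_mod_cast hn
  -- The choice `m = n^{1/3}` balances the two contributions `1/m` and `√(m/n)`.
  set m : ℝ := (n : ℝ) ^ (1 / 3 : ℝ) with hm
  have hm0 : 0 < m := Real.rpow_pos_of_pos hn' _
  have hm3 : (n : ℝ) = m ^ 3 := by
    rw [hm, ← Real.rpow_natCast, ← Real.rpow_mul hn'.le]; norm_num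
  have key := norm_integral_osc_le (A := -(Real.pi / 2)) (B := Real.pi / 2) (m := m)
    (φ := fun ξ => n * disp r ξ + z * ξ) (g := fun ξ => (√(dispSq r ξ))⁻¹) (κ := n * κ)
    (φ₁ := fun ξ => n * (r * Real.sin ξ / √(dispSq r ξ)) + z * 1)
    (φ₂ := fun ξ => n * (r * (1 - r ^ 2) * Real.cos ξ / √(dispSq r ξ) ^ 3))
    (G := G) (G₁ := G₁) (by linarith [Real.pi_pos])
    (fun ξ => ((hasDerivAt_disp h0 h1 ξ).const_mul _).add ((hasDerivAt_id ξ).const_mul z))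
    (fun ξ => ((hasDerivAt_deriv_disp h0 h1 ξ).const_mul _).add_const _)
    (by
      refine continuous_const.mul (Continuous.div (by fun_prop) (cD.pow 3) fun ξ => ?_)
      exact pow_ne_zero 3 (hDne ξ))
    (fun ξ => hasDerivAt_inv_sqrt_dispSq h0 h1 ξ)
    (by
      refine Continuous.div (Continuous.neg (Continuous.div (by fun_prop) cD hDne)) (cD.pow 2)
        fun ξ => pow_ne_zero 2 (hDne ξ))
    hm0 (mul_pos hn' hκ0)
    (fun ξ hξ => by
      have := Real.cos_nonneg_of_mem_Icc hξ
      have h2 : 0 ≤ 1 - r ^ 2 := by nlinarith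
      positivity)
    (fun x hx y hy hxy => by
      have := mul_le_mul_of_nonneg_left (deriv_disp_growth h0 h1 hx hy hxy) hn'.le
      rw [mul_assoc]
      linarith)
    (fun ξ => by
      rw [abs_inv, abs_of_nonneg (Real.sqrt_nonneg _)]
      exact inv_anti₀ hρ0 (hDl ξ))
    (fun ξ => by
      rw [abs_div, abs_neg, abs_div, div_div, abs_of_nonneg (Real.sqrt_nonneg _),
        abs_of_nonneg (sq_nonneg √(dispSq r ξ)), ← pow_succ']
      refine div_le_div₀ zero_le_one ?_ (by positivity) (pow_le_pow_left₀ hρ0.le (hDl ξ) 3)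
      rw [abs_mul, abs_mul, abs_of_nonneg (sq_nonneg r)]
      refine mul_le_one₀ (mul_le_one₀ (by nlinarith) (abs_nonneg _) (Real.abs_cos_le_one _))
        (abs_nonneg _) (Real.abs_sin_le_one _))
  refine key.trans (le_of_eq ?_)
  have e1 : (n : ℝ) ^ (-(1 / 3) : ℝ) = m⁻¹ := by rw [hm, Real.rpow_neg hn'.le]
  have e2 : √(2 * m / (n * κ)) = √(2 / κ) * m⁻¹ := by
    rw [hm3, show 2 * m / (m ^ 3 * κ) = 2 / κ * (m⁻¹) ^ 2 by field_simp,
      Real.sqrt_mul (by positivity), Real.sqrt_sq (by positivity)]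
  rw [e1, e2]
  ring

end

/-! ### Decay of the Chebyshev kernel -/

/-- The Fourier coefficients of `sin (k θ) / sin θ`, where `cos θ = r cos ξ`. -/
def chebKer (r : ℝ) (k : ℕ) (y : ℤ) : ℂ :=
  (2 * Real.pi : ℂ)⁻¹ * ∫ ξ in (-(Real.pi / 2))..(3 * Real.pi / 2),
    Complex.exp ((y * ξ : ℝ) * Complex.I) * (Real.sin (k * disp r ξ) / √(dispSq r ξ) : ℝ)

section

variable {r : ℝ}

theorem continuous_disp : Continuous (disp r) := by
  unfold disp
  fun_prop

theorem continuous_chebKer_integrand (h0 : 0 < r) (h1 : r < 1) (k : ℕ) (y : ℤ) :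
    Continuous fun ξ : ℝ => Complex.exp ((y * ξ : ℝ) * Complex.I) *
      (Real.sin (k * disp r ξ) / √(dispSq r ξ) : ℝ) := by
  have h : Continuous fun ξ : ℝ => Real.sin (k * disp r ξ) / √(dispSq r ξ) :=
    (Real.continuous_sin.comp (continuous_const.mul continuous_disp)).div continuous_dispSq.sqrt
      fun ξ => (Real.sqrt_pos.2 (dispSq_pos h0 h1 ξ)).ne'
  have h2 : Continuous fun ξ : ℝ => Complex.exp ((y * ξ : ℝ) * Complex.I) := by fun_prop
  exact h2.mul (Complex.continuous_ofReal.comp h)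

theorem chebKer_zero (y : ℤ) : chebKer r 0 y = 0 := by
  simp [chebKer]

theorem chebKer_one (h0 : 0 < r) (h1 : r < 1) (y : ℤ) : chebKer r 1 y = if y = 0 then 1 else 0 := by
  have e : ∀ ξ : ℝ, Complex.exp ((y * ξ : ℝ) * Complex.I) *
      (Real.sin ((1 : ℕ) * disp r ξ) / √(dispSq r ξ) : ℝ) = Complex.exp ((y * Complex.I) * ξ) := by
    intro ξ
    rw [Nat.cast_one, one_mul, sin_disp, div_self (Real.sqrt_pos.2 (dispSq_pos h0 h1 ξ)).ne']
    push_cast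
    rw [mul_one]
    congr 1
    ring
  unfold chebKer
  simp only [e]
  split_ifs with hy
  · subst hy
    have : (Real.pi : ℂ) ≠ 0 := by exact_mod_cast Real.pi_ne_zero
    simp
    field_simp
    norm_num
  · have hy' : (y : ℂ) * Complex.I ≠ 0 := mul_ne_zero (by exact_mod_cast hy) Complex.I_ne_zero
    rw [integral_exp_mul_complex hy']
    have : (y * Complex.I) * ((3 * Real.pi / 2 : ℝ) : ℂ)
        = (y * Complex.I) * ((-(Real.pi / 2) : ℝ) : ℂ) + y * (2 * Real.pi * Complex.I) := by
      push_cast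
      ring
    rw [this, Complex.exp_add, Complex.exp_int_mul_two_pi_mul_I]
    simp

/-- This is `sin((k+2)θ) = 2 cos θ sin((k+1)θ) - sin(kθ)` with `cos θ = r cos ξ`: multiplication by
`2 cos ξ` adds the two neighbouring Fourier coefficients. -/
theorem chebKer_add_two (h0 : 0 < r) (h1 : r < 1) (k : ℕ) (y : ℤ) :
    chebKer r (k + 2) y = r * (chebKer r (k + 1) (y + 1) + chebKer r (k + 1) (y - 1))
      - chebKer r k y := by
  have I := fun k y => (continuous_chebKer_integrand h0 h1 k y).intervalIntegrable
    (μ := MeasureTheory.volume) (-(Real.pi / 2)) (3 * Real.pi / 2)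
  unfold chebKer
  rw [← mul_add, ← intervalIntegral.integral_add (I _ _) (I _ _), mul_left_comm, ← mul_sub]
  congr 1
  rw [← intervalIntegral.integral_const_mul, ← intervalIntegral.integral_sub
      (((I _ _).add (I _ _)).const_mul _) (I _ _)]
  refine intervalIntegral.integral_congr fun ξ _ => ?_
  have hs : Real.sin ((k + 2 : ℕ) * disp r ξ)
      = 2 * (r * Real.cos ξ) * Real.sin ((k + 1 : ℕ) * disp r ξ) - Real.sin (k * disp r ξ) := by
    rw [← cos_disp h0 h1 ξ]
    have e1 : ((k + 2 : ℕ) : ℝ) * disp r ξ = (k + 1 : ℕ) * disp r ξ + disp r ξ := by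
      push_cast; ring
    have e2 : (k : ℝ) * disp r ξ = (k + 1 : ℕ) * disp r ξ - disp r ξ := by push_cast; ring
    rw [e1, e2, Real.sin_add, Real.sin_sub]
    ring
  have hc : Complex.exp (((y + 1 : ℤ) * ξ : ℝ) * Complex.I)
      + Complex.exp (((y - 1 : ℤ) * ξ : ℝ) * Complex.I)
      = Complex.exp ((y * ξ : ℝ) * Complex.I) * (2 * Real.cos ξ : ℝ) := by
    push_cast
    rw [show ((y : ℂ) + 1) * ξ * Complex.I = y * ξ * Complex.I + ξ * Complex.I by ring,
      show ((y : ℂ) - 1) * ξ * Complex.I = y * ξ * Complex.I + -ξ * Complex.I by ring,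
      Complex.exp_add, Complex.exp_add, Complex.cos]
    ring
  rw [← add_mul, hc, hs]
  push_cast
  ring

theorem disp_add_pi (ξ : ℝ) : disp r (ξ + Real.pi) = Real.pi - disp r ξ := by
  rw [disp, Real.cos_add_pi, mul_neg, Real.arccos_neg, disp]

/-- Translation by `π` replaces `θ` by `π - θ`, which multiplies the integrand by a constant of
modulus one. Hence only the half period with `cos ξ ≥ 0`, where `θ` is convex, has to be estimated;
the period is cut at the zeros of `cos ξ` for this purpose. -/
theorem norm_integral_chebKer_shift (k : ℕ) (y : ℤ) :
    ‖∫ ξ in (Real.pi / 2)..(3 * Real.pi / 2), Complex.exp ((y * ξ : ℝ) * Complex.I) *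
      (Real.sin (k * disp r ξ) / √(dispSq r ξ) : ℝ)‖
    = ‖∫ ξ in (-(Real.pi / 2))..(Real.pi / 2), Complex.exp ((y * ξ : ℝ) * Complex.I) *
      (Real.sin (k * disp r ξ) / √(dispSq r ξ) : ℝ)‖ := by
  have h := intervalIntegral.integral_comp_add_right (a := -(Real.pi / 2)) (b := Real.pi / 2)
    (fun ξ : ℝ => Complex.exp ((y * ξ : ℝ) * Complex.I) *
      (Real.sin (k * disp r ξ) / √(dispSq r ξ) : ℝ)) Real.pi
  rw [show -(Real.pi / 2) + Real.pi = Real.pi / 2 by ring,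
    show Real.pi / 2 + Real.pi = 3 * Real.pi / 2 by ring] at h
  rw [← h]
  have e : ∀ ξ : ℝ, Complex.exp ((y * (ξ + Real.pi) : ℝ) * Complex.I) *
      (Real.sin (k * disp r (ξ + Real.pi)) / √(dispSq r (ξ + Real.pi)) : ℝ)
      = (Complex.exp ((y * Real.pi : ℝ) * Complex.I) * (-(-1) ^ k : ℝ)) *
        (Complex.exp ((y * ξ : ℝ) * Complex.I) *
          (Real.sin (k * disp r ξ) / √(dispSq r ξ) : ℝ)) := by
    intro ξ
    have e1 : dispSq r (ξ + Real.pi) = dispSq r ξ := by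
      simp [dispSq]
    have e2 : Real.sin (k * disp r (ξ + Real.pi)) = (-(-1) ^ k) * Real.sin (k * disp r ξ) := by
      rw [disp_add_pi, mul_sub, Real.sin_sub, Real.sin_nat_mul_pi, Real.cos_nat_mul_pi]
      ring
    rw [e1, e2, mul_add, Complex.ofReal_add, add_mul, Complex.exp_add]
    push_cast
    ring
  simp only [e]
  rw [intervalIntegral.integral_const_mul, norm_mul, norm_mul, Complex.norm_exp_ofReal_mul_I,
    Complex.norm_real]
  simp

theorem exists_norm_chebKer_le (h0 : 0 < r) (h1 : r < 1) :
    ∃ C : ℝ, 0 < C ∧ ∀ k : ℕ, ∀ y : ℤ, ‖chebKer r k y‖ ≤ C * (1 + k : ℝ) ^ (-(1 / 3) : ℝ) := by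
  obtain ⟨C, hC, hb⟩ := exists_norm_integral_disp_le h0 h1
  refine ⟨2 * C, by linarith, fun k y => ?_⟩
  rcases Nat.eq_zero_or_pos k with rfl | hk
  · rw [chebKer_zero, norm_zero]
    positivity
  have hk' : (1 : ℝ) ≤ k := by exact_mod_cast hk
  have cg : Continuous fun ξ : ℝ => (√(dispSq r ξ))⁻¹ :=
    continuous_dispSq.sqrt.inv₀ fun ξ => (Real.sqrt_pos.2 (dispSq_pos h0 h1 ξ)).ne'
  have cE : ∀ z : ℝ, Continuous fun ξ : ℝ =>
      Complex.exp ((k * disp r ξ + z * ξ : ℝ) * Complex.I) * ((√(dispSq r ξ))⁻¹ : ℝ) := by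
    intro z
    refine Continuous.mul ?_ (Complex.continuous_ofReal.comp cg)
    refine Complex.continuous_exp.comp (Continuous.mul (Complex.continuous_ofReal.comp ?_)
      continuous_const)
    exact (continuous_const.mul continuous_disp).add (continuous_const.mul continuous_id)
  set E : ℝ → ℝ → ℂ := fun z ξ =>
    Complex.exp ((k * disp r ξ + z * ξ : ℝ) * Complex.I) * ((√(dispSq r ξ))⁻¹ : ℝ) with hE
  -- Writing the sine with exponentials produces the phase `-kθ`, which is concave; conjugation
  -- turns it into `kθ` with frequency `-y`, so the convex estimate covers both terms.
  have hsplit : ∀ ξ : ℝ, Complex.exp ((y * ξ : ℝ) * Complex.I) *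
      (Real.sin (k * disp r ξ) / √(dispSq r ξ) : ℝ)
      = (2 * Complex.I)⁻¹ * (E y ξ - conj (E (-y) ξ)) := by
    intro ξ
    simp only [hE, map_mul, Complex.conj_ofReal, ← Complex.exp_conj, Complex.conj_I]
    rw [show ((k * disp r ξ + y * ξ : ℝ) : ℂ) * Complex.I
        = (y * ξ : ℝ) * Complex.I + (k * disp r ξ : ℝ) * Complex.I by push_cast; ring,
      show ((k * disp r ξ + -y * ξ : ℝ) : ℂ) * -Complex.I
        = (y * ξ : ℝ) * Complex.I + -(k * disp r ξ : ℝ) * Complex.I by push_cast; ring,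
      Complex.exp_add, Complex.exp_add, Complex.ofReal_div, Complex.ofReal_sin, Complex.sin,
      mul_inv, Complex.inv_I, Complex.ofReal_inv]
    ring
  have hhalf : ‖∫ ξ in (-(Real.pi / 2))..(Real.pi / 2), Complex.exp ((y * ξ : ℝ) * Complex.I) *
      (Real.sin (k * disp r ξ) / √(dispSq r ξ) : ℝ)‖ ≤ C * (k : ℝ) ^ (-(1 / 3) : ℝ) := by
    simp only [hsplit]
    have i1 : IntervalIntegrable (E y) MeasureTheory.volume (-(Real.pi / 2)) (Real.pi / 2) :=
      (cE y).intervalIntegrable _ _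
    have i2 : IntervalIntegrable (fun ξ => conj (E (-y) ξ)) MeasureTheory.volume
        (-(Real.pi / 2)) (Real.pi / 2) :=
      (Complex.continuous_conj.comp (cE (-y))).intervalIntegrable _ _
    rw [intervalIntegral.integral_const_mul, intervalIntegral.integral_sub i1 i2, norm_mul]
    have hconj : ∫ ξ in (-(Real.pi / 2))..(Real.pi / 2), conj (E (-y) ξ)
        = conj (∫ ξ in (-(Real.pi / 2))..(Real.pi / 2), E (-y) ξ) := by
      rw [intervalIntegral.integral_of_le (by linarith [Real.pi_pos]),
        intervalIntegral.integral_of_le (by linarith [Real.pi_pos])]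
      exact integral_conj
    rw [hconj]
    have h2 := norm_sub_le (∫ ξ in (-(Real.pi / 2))..(Real.pi / 2), E y ξ)
      (conj (∫ ξ in (-(Real.pi / 2))..(Real.pi / 2), E (-y) ξ))
    rw [RCLike.norm_conj] at h2
    have h3 := hb k hk y
    have h4 := hb k hk (-y)
    have h5 : ‖(2 * Complex.I)⁻¹‖ = 1 / 2 := by simp
    rw [h5]
    linarith
  have I := fun s t => (continuous_chebKer_integrand h0 h1 k y).intervalIntegrable
    (μ := MeasureTheory.volume) s t
  have hpi : ‖(2 * Real.pi : ℂ)⁻¹‖ ≤ 1 / 2 := by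
    rw [norm_inv, norm_mul, Complex.norm_real, Real.norm_of_nonneg Real.pi_pos.le, inv_eq_one_div]
    refine one_div_le_one_div_of_le (by norm_num) ?_
    simp
    linarith [Real.pi_gt_three]
  have hfull : ‖chebKer r k y‖ ≤ C * (k : ℝ) ^ (-(1 / 3) : ℝ) := by
    unfold chebKer
    rw [← intervalIntegral.integral_add_adjacent_intervals (I (-(Real.pi / 2)) (Real.pi / 2))
      (I (Real.pi / 2) (3 * Real.pi / 2)), norm_mul]
    have h2 := norm_add_le (∫ ξ in (-(Real.pi / 2))..(Real.pi / 2),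
      Complex.exp ((y * ξ : ℝ) * Complex.I) * (Real.sin (k * disp r ξ) / √(dispSq r ξ) : ℝ))
      (∫ ξ in (Real.pi / 2)..(3 * Real.pi / 2),
      Complex.exp ((y * ξ : ℝ) * Complex.I) * (Real.sin (k * disp r ξ) / √(dispSq r ξ) : ℝ))
    rw [norm_integral_chebKer_shift] at h2
    refine (mul_le_mul hpi h2 (norm_nonneg _) (by norm_num)).trans ?_
    linarith
  refine hfull.trans ?_
  rw [mul_comm 2 C, mul_assoc]
  refine mul_le_mul_of_nonneg_left ?_ hC.le
  calc (k : ℝ) ^ (-(1 / 3) : ℝ) ≤ ((1 + k : ℝ) / 2) ^ (-(1 / 3) : ℝ) :=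
        Real.rpow_le_rpow_of_nonpos (by positivity) (by linarith) (by norm_num)
    _ = (1 / 2 : ℝ) ^ (-(1 / 3) : ℝ) * (1 + k : ℝ) ^ (-(1 / 3) : ℝ) := by
        rw [← Real.mul_rpow (by norm_num) (by positivity)]; congr 1; ring
    _ ≤ 2 * (1 + k : ℝ) ^ (-(1 / 3) : ℝ) := by
        refine mul_le_mul_of_nonneg_right ?_ (by positivity)
        calc (1 / 2 : ℝ) ^ (-(1 / 3) : ℝ) ≤ (1 / 2 : ℝ) ^ (-1 : ℝ) :=
              Real.rpow_le_rpow_of_exponent_ge (by norm_num) (by norm_num) (by norm_num)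
          _ = 2 := by rw [Real.rpow_neg_one]; norm_num

end

/-! ### The linear walk and its dispersive estimate -/

/-- The kernel `q_k` with `U₀^{t+1} f = q_{t+1} * U₀ f - q_t * f`. -/
def walkKer (a : ℂ) (k : ℕ) (y : ℤ) : ℂ := (a / ‖a‖) ^ y * chebKer ‖a‖ k y

theorem walkKer_zero (a : ℂ) (y : ℤ) : walkKer a 0 y = 0 := by
  rw [walkKer, chebKer_zero, mul_zero]

section

variable {a b : ℂ}

theorem walkKer_one (h0 : 0 < ‖a‖) (h1 : ‖a‖ < 1) (y : ℤ) :
    walkKer a 1 y = if y = 0 then 1 else 0 := by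
  rw [walkKer, chebKer_one h0 h1]
  split_ifs with h
  · simp [h]
  · simp

/-- The factor `(a/|a|)^y` turns the symmetric coefficients `r, r` of the Chebyshev recursion into
`a, conj a`, matching the Cayley–Hamilton identity. -/
theorem walkKer_add_two (h0 : 0 < ‖a‖) (h1 : ‖a‖ < 1) (k : ℕ) (y : ℤ) :
    walkKer a (k + 2) y = a * walkKer a (k + 1) (y - 1) + conj a * walkKer a (k + 1) (y + 1)
      - walkKer a k y := by
  have hn : (‖a‖ : ℂ) ≠ 0 := by exact_mod_cast h0.ne'
  have ha : a ≠ 0 := norm_pos_iff.1 h0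
  have hw : a / (‖a‖ : ℂ) ≠ 0 := div_ne_zero ha hn
  have hc : conj a * a = (‖a‖ : ℂ) ^ 2 := Complex.conj_mul' a
  have hc' : conj a * (a / ‖a‖) = ‖a‖ := by
    field_simp
    exact hc
  simp only [walkKer]
  rw [chebKer_add_two h0 h1, zpow_add_one₀ hw, zpow_sub_one₀ hw]
  have e1 : a * (a / (‖a‖ : ℂ))⁻¹ = ‖a‖ := by field_simp
  linear_combination (-(a / (‖a‖ : ℂ)) ^ y * chebKer ‖a‖ (k + 1) (y - 1)) * e1
    - ((a / (‖a‖ : ℂ)) ^ y * chebKer ‖a‖ (k + 1) (y + 1)) * hc'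

theorem exists_norm_walkKer_le (h0 : 0 < ‖a‖) (h1 : ‖a‖ < 1) :
    ∃ C : ℝ, 0 < C ∧ ∀ k : ℕ, ∀ y : ℤ, ‖walkKer a k y‖ ≤ C * (1 + k : ℝ) ^ (-(1 / 3) : ℝ) := by
  obtain ⟨C, hC, h⟩ := exists_norm_chebKer_le h0 h1
  refine ⟨C, hC, fun k y => ?_⟩
  rw [walkKer, norm_mul, norm_zpow, norm_div, Complex.norm_real, norm_norm, div_self h0.ne',
    one_zpow, one_mul]
  exact h k y

variable {C₀ : U2}

theorem shift_apply (u : State) (x : ℤ) : shift u x = !₂[u (x + 1) 0, u (x - 1) 1] := rfl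

theorem linCoin_apply (u : State) (x : ℤ) : linCoin C₀ u x = act C₀ (u x) := rfl

theorem U0_eq (u : State) : U0 C₀ u = shift (linCoin C₀ u) := rfl

theorem U0_apply_zero (hC₀ : (C₀ : Matrix (Fin 2) (Fin 2) ℂ) = !![a, b; -conj b, conj a])
    (u : State) (x : ℤ) : U0 C₀ u x 0 = a * u (x + 1) 0 + b * u (x + 1) 1 := by
  simp [U0_eq, shift_apply, linCoin_apply, act, hC₀, dotProduct]

theorem U0_apply_one (hC₀ : (C₀ : Matrix (Fin 2) (Fin 2) ℂ) = !![a, b; -conj b, conj a])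
    (u : State) (x : ℤ) : U0 C₀ u x 1 = -conj b * u (x - 1) 0 + conj a * u (x - 1) 1 := by
  simp [U0_eq, shift_apply, linCoin_apply, act, hC₀, dotProduct]

/-- The Cayley–Hamilton identity for the walk. -/
theorem U0_U0_apply (hab : ‖a‖ ^ 2 + ‖b‖ ^ 2 = 1)
    (hC₀ : (C₀ : Matrix (Fin 2) (Fin 2) ℂ) = !![a, b; -conj b, conj a]) (u : State) (x : ℤ)
    (i : Fin 2) : U0 C₀ (U0 C₀ u) x i
      = a * U0 C₀ u (x + 1) i + conj a * U0 C₀ u (x - 1) i - u x i := by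
  have h : conj a * a + conj b * b = 1 := by
    rw [Complex.conj_mul', Complex.conj_mul']
    exact_mod_cast hab
  fin_cases i
  · simp only [Fin.zero_eta, Fin.isValue, U0_apply_zero hC₀, U0_apply_one hC₀, add_sub_cancel_right,
      sub_add_cancel]
    linear_combination (-u x 0) * h
  · simp only [Fin.mk_one, Fin.isValue, U0_apply_zero hC₀, U0_apply_one hC₀, add_sub_cancel_right,
      sub_add_cancel]
    linear_combination (-u x 1) * h

/-- The `ℓ¹` norm. -/
def l1 (u : State) : ℝ := ∑' x, ‖u x‖

theorem l1_nonneg (u : State) : 0 ≤ l1 u := tsum_nonneg fun _ => norm_nonneg _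

theorem norm_coord_le (v : Spin) (i : Fin 2) : ‖v i‖ ≤ ‖v‖ := PiLp.norm_apply_le v i

theorem norm_spin_le (v : Spin) : ‖v‖ ≤ ‖v 0‖ + ‖v 1‖ := by
  refine le_of_sq_le_sq ?_ (by positivity)
  rw [norm_sq_spin]
  nlinarith [mul_nonneg (norm_nonneg (v 0)) (norm_nonneg (v 1))]

theorem norm_U0_apply_le (u : State) (x : ℤ) : ‖U0 C₀ u x‖ ≤ ‖u (x + 1)‖ + ‖u (x - 1)‖ := by
  refine (norm_spin_le _).trans (add_le_add ?_ ?_)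
  · rw [← norm_act C₀ (u (x + 1))]
    exact norm_coord_le (act C₀ (u (x + 1))) 0
  · rw [← norm_act C₀ (u (x - 1))]
    exact norm_coord_le (act C₀ (u (x - 1))) 1

theorem summable_norm_add (u : State) (hu : Summable fun x => ‖u x‖) (n : ℤ) :
    Summable fun x => ‖u (x + n)‖ := by
  have h := (Equiv.summable_iff (f := fun x => ‖u x‖) (Equiv.addRight n)).2 hu
  exact h

theorem summable_norm_U0 {u : State} (hu : Summable fun x => ‖u x‖) :
    Summable fun x => ‖U0 C₀ u x‖ := by
  have h := (summable_norm_add u hu 1).add (summable_norm_add u hu (-1))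
  exact h.of_nonneg_of_le (fun _ => norm_nonneg _) (norm_U0_apply_le u)

theorem l1_U0_le {u : State} (hu : Summable fun x => ‖u x‖) : l1 (U0 C₀ u) ≤ 2 * l1 u := by
  have h1 := summable_norm_add u hu 1
  have h2 := summable_norm_add u hu (-1)
  have e : ∀ n : ℤ, ∑' x, ‖u (x + n)‖ = l1 u := fun n => (Equiv.addRight n).tsum_eq fun x => ‖u x‖
  calc l1 (U0 C₀ u) ≤ ∑' x, (‖u (x + 1)‖ + ‖u (x + -1)‖) :=
        (summable_norm_U0 hu).tsum_le_tsum (norm_U0_apply_le u) (h1.add h2)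
    _ = 2 * l1 u := by rw [h1.tsum_add h2, e, e, two_mul]

theorem summable_coord {u : State} (hu : Summable fun x => ‖u x‖) (i : Fin 2) :
    Summable fun x => ‖u x i‖ :=
  hu.of_nonneg_of_le (fun _ => norm_nonneg _) fun _ => norm_coord_le _ _

theorem summable_ker_mul {q F : ℤ → ℂ} {M : ℝ} (hq : ∀ y, ‖q y‖ ≤ M)
    (hF : Summable fun x => ‖F x‖) (x : ℤ) : Summable fun y => q y * F (x + y) := by
  have h := (Equiv.addLeft x).summable_iff.2 hF
  refine Summable.of_norm_bounded (h.mul_left M) fun y => ?_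
  rw [norm_mul]
  exact mul_le_mul_of_nonneg_right (hq y) (norm_nonneg _)

theorem norm_tsum_ker_mul_le {q F : ℤ → ℂ} {M : ℝ} (hq : ∀ y, ‖q y‖ ≤ M)
    (hF : Summable fun x => ‖F x‖) (x : ℤ) :
    ‖∑' y, q y * F (x + y)‖ ≤ M * ∑' x, ‖F x‖ := by
  have h := (Equiv.addLeft x).summable_iff.2 hF
  have e := (Equiv.addLeft x).tsum_eq fun x => ‖F x‖
  rw [← e]
  refine tsum_of_norm_bounded (h.mul_left M).hasSum (fun y => ?_) |>.trans (le_of_eq ?_)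
  · rw [norm_mul]
    exact mul_le_mul_of_nonneg_right (hq y) (norm_nonneg _)
  · exact tsum_mul_left

/-- By induction: the formula for `U₀ u` contains `U₀² u`, which Cayley–Hamilton reduces to
translates of `U₀ u` and to `u`; after reindexing, the coefficients recombine by the three-term
recursion of the kernel. Bounded kernels and `ℓ¹` data make all the sums converge. -/
theorem U0_pow_succ_apply (hab : ‖a‖ ^ 2 + ‖b‖ ^ 2 = 1) (h0 : 0 < ‖a‖) (h1 : ‖a‖ < 1)
    (hC₀ : (C₀ : Matrix (Fin 2) (Fin 2) ℂ) = !![a, b; -conj b, conj a]) (t : ℕ) :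
    ∀ {u : State}, (Summable fun x => ‖u x‖) → ∀ (x : ℤ) (i : Fin 2),
    (U0 C₀ ^ (t + 1)) u x i = ∑' y, walkKer a (t + 1) y * U0 C₀ u (x + y) i
      - ∑' y, walkKer a t y * u (x + y) i := by
  obtain ⟨C, hC, hb⟩ := exists_norm_walkKer_le h0 h1
  have hq : ∀ k y, ‖walkKer a k y‖ ≤ C := fun k y => (hb k y).trans
    (mul_le_of_le_one_right hC.le (Real.rpow_le_one_of_one_le_of_nonpos
      (by linarith [Nat.cast_nonneg (α := ℝ) k]) (by norm_num)))
  induction t with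
  | zero =>
    intro u hu x i
    simp [walkKer_zero, walkKer_one h0 h1]
  | succ t ih =>
    intro u hu x i
    have hUu := summable_norm_U0 (C₀ := C₀) hu
    have s1 := fun k x => summable_ker_mul (hq k) (summable_coord hUu i) x
    have s2 := fun k x => summable_ker_mul (hq k) (summable_coord hu i) x
    have step : (U0 C₀ ^ (t + 1 + 1)) u = (U0 C₀ ^ (t + 1)) (U0 C₀ u) := by
      rw [pow_succ (U0 C₀) (t + 1)]
      rfl
    rw [step, ih hUu]
    simp only [U0_U0_apply hab hC₀ u]
    have e1 : ∑' y, walkKer a (t + 1) y * (a * U0 C₀ u (x + y + 1) i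
        + conj a * U0 C₀ u (x + y - 1) i - u (x + y) i)
        = ∑' y, a * (walkKer a (t + 1) y * U0 C₀ u (x + 1 + y) i)
        + ∑' y, conj a * (walkKer a (t + 1) y * U0 C₀ u (x - 1 + y) i)
        - ∑' y, walkKer a (t + 1) y * u (x + y) i := by
      rw [← ((s1 _ _).mul_left _).tsum_add ((s1 _ _).mul_left _),
        ← (((s1 _ _).mul_left _).add ((s1 _ _).mul_left _)).tsum_sub (s2 _ _)]
      refine tsum_congr fun y => ?_
      rw [show x + 1 + y = x + y + 1 by ring, show x - 1 + y = x + y - 1 by ring]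
      ring
    have e2 : ∑' y, a * (walkKer a (t + 1) y * U0 C₀ u (x + 1 + y) i)
        = ∑' y, a * (walkKer a (t + 1) (y - 1) * U0 C₀ u (x + y) i) := by
      rw [← (Equiv.subRight (1 : ℤ)).tsum_eq]
      refine tsum_congr fun y => ?_
      rw [Equiv.subRight_apply, show x + 1 + (y - 1) = x + y by ring]
    have e3 : ∑' y, conj a * (walkKer a (t + 1) y * U0 C₀ u (x - 1 + y) i)
        = ∑' y, conj a * (walkKer a (t + 1) (y + 1) * U0 C₀ u (x + y) i) := by
      rw [← (Equiv.addRight (1 : ℤ)).tsum_eq]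
      refine tsum_congr fun y => ?_
      rw [Equiv.coe_addRight, show x - 1 + (y + 1) = x + y by ring]
    have s3 := fun d x => summable_ker_mul (q := fun y => walkKer a (t + 1) (y + d))
      (fun y => hq (t + 1) (y + d)) (summable_coord hUu i) x
    have e4 : ∑' y, walkKer a (t + 1 + 1) y * U0 C₀ u (x + y) i
        = ∑' y, a * (walkKer a (t + 1) (y - 1) * U0 C₀ u (x + y) i)
        + ∑' y, conj a * (walkKer a (t + 1) (y + 1) * U0 C₀ u (x + y) i)
        - ∑' y, walkKer a t y * U0 C₀ u (x + y) i := by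
      have s4 := s3 (-1) x
      simp only [← sub_eq_add_neg] at s4
      rw [← (s4.mul_left _).tsum_add ((s3 1 x).mul_left _),
        ← ((s4.mul_left _).add ((s3 1 x).mul_left _)).tsum_sub (s1 _ _)]
      refine tsum_congr fun y => ?_
      rw [walkKer_add_two h0 h1]
      ring
    rw [e1, e2, e3, e4]
    ring

/-- The decay rate `(1 + t)^{-1/3}` of the linear walk. -/
def dec (t : ℕ) : ℝ := (1 + t : ℝ) ^ (-(1 / 3) : ℝ)

theorem dec_pos (t : ℕ) : 0 < dec t := Real.rpow_pos_of_pos (by positivity) _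

theorem dec_le_two_mul_dec_succ (t : ℕ) : dec t ≤ 2 * dec (t + 1) := by
  calc dec t ≤ ((1 + (t + 1 : ℕ) : ℝ) / 2) ^ (-(1 / 3) : ℝ) :=
        Real.rpow_le_rpow_of_nonpos (by positivity)
          (by push_cast; linarith [Nat.cast_nonneg (α := ℝ) t]) (by norm_num)
    _ = (1 / 2 : ℝ) ^ (-(1 / 3) : ℝ) * dec (t + 1) := by
        rw [dec, ← Real.mul_rpow (by norm_num) (by positivity)]; congr 1; ring
    _ ≤ 2 * dec (t + 1) := by
        refine mul_le_mul_of_nonneg_right ?_ (dec_pos _).le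
        calc (1 / 2 : ℝ) ^ (-(1 / 3) : ℝ) ≤ (1 / 2 : ℝ) ^ (-1 : ℝ) :=
              Real.rpow_le_rpow_of_exponent_ge (by norm_num) (by norm_num) (by norm_num)
          _ = 2 := by rw [Real.rpow_neg_one]; norm_num

/-- The dispersive estimate for the linear walk. -/
theorem exists_norm_U0_pow_apply_le (hab : ‖a‖ ^ 2 + ‖b‖ ^ 2 = 1) (h0 : 0 < ‖a‖) (h1 : ‖a‖ < 1)
    (hC₀ : (C₀ : Matrix (Fin 2) (Fin 2) ℂ) = !![a, b; -conj b, conj a]) :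
    ∃ C : ℝ, 0 < C ∧ ∀ (t : ℕ) (u : State), (Summable fun x => ‖u x‖) → ∀ x,
      ‖(U0 C₀ ^ t) u x‖ ≤ C * dec t * l1 u := by
  obtain ⟨C, hC, hb⟩ := exists_norm_walkKer_le h0 h1
  refine ⟨8 * C + 1, by linarith, fun t u hu x => ?_⟩
  have hd := dec_pos t
  have hl := l1_nonneg u
  rcases t with _ | t
  · have e : dec 0 = 1 := by simp [dec]
    rw [e, pow_zero, mul_one]
    have : ‖u x‖ ≤ l1 u := hu.le_tsum x fun _ _ => norm_nonneg _
    refine this.trans ?_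
    nlinarith
  · have hcoord : ∀ i, ‖(U0 C₀ ^ (t + 1)) u x i‖ ≤ 4 * C * dec (t + 1) * l1 u := by
      intro i
      rw [U0_pow_succ_apply hab h0 h1 hC₀ t hu]
      have hUu := summable_norm_U0 (C₀ := C₀) hu
      have b1 := norm_tsum_ker_mul_le (hb (t + 1)) (summable_coord hUu i) x
      have b2 := norm_tsum_ker_mul_le (hb t) (summable_coord hu i) x
      have b3 : ∑' x, ‖U0 C₀ u x i‖ ≤ 2 * l1 u :=
        ((summable_coord hUu i).tsum_le_tsum (fun _ => norm_coord_le _ _) hUu).trans (l1_U0_le hu)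
      have b4 : ∑' x, ‖u x i‖ ≤ l1 u :=
        (summable_coord hu i).tsum_le_tsum (fun _ => norm_coord_le _ _) hu
      have b5 : C * dec t ≤ C * (2 * dec (t + 1)) :=
        mul_le_mul_of_nonneg_left (dec_le_two_mul_dec_succ t) hC.le
      have b6 : C * dec (t + 1) * ∑' x, ‖U0 C₀ u x i‖ ≤ C * dec (t + 1) * (2 * l1 u) :=
        mul_le_mul_of_nonneg_left b3 (mul_pos hC hd).le
      have b7 : C * dec t * ∑' x, ‖u x i‖ ≤ C * (2 * dec (t + 1)) * l1 u :=
        mul_le_mul b5 b4 (tsum_nonneg fun _ => norm_nonneg _) (by positivity)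
      refine (norm_sub_le _ _).trans ((add_le_add (b1.trans b6) (b2.trans b7)).trans (le_of_eq ?_))
      ring
    have := mul_nonneg hd.le hl
    refine (norm_spin_le _).trans ((add_le_add (hcoord 0) (hcoord 1)).trans ?_)
    nlinarith

end

/-! ### Real interpolation -/

section Interpolation

open MeasureTheory

theorem summable_norm_pow_add_two (u : State) (n : ℕ) : Summable fun x => ‖u x‖ ^ (n + 2) := by
  refine ((summable_sq u).mul_left (‖u‖ ^ n)).of_nonneg_of_le (fun _ => by positivity) fun x => ?_
  rw [pow_add]
  exact mul_le_mul_of_nonneg_right (pow_le_pow_left₀ (norm_nonneg _)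
    (lp.norm_apply_le_norm two_ne_zero u x) n) (sq_nonneg _)

/-- The restriction of a state to a set of sites. -/
def restrict (s : Set ℤ) (u : State) : State :=
  ⟨s.indicator u, memlp_of_summable_sq ((summable_sq u).of_nonneg_of_le (fun _ => sq_nonneg _)
    fun _ => pow_le_pow_left₀ (norm_nonneg _) (norm_indicator_le_norm_self _ _) 2)⟩

variable {T : State ≃ₗᵢ[ℂ] State} {M K : ℝ} {f : State} {w : ℤ → ℝ}

theorem tsum_ofReal_norm_sq (u : State) :
    ∑' x, ENNReal.ofReal (‖u x‖ ^ 2) = ENNReal.ofReal (‖u‖ ^ 2) := by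
  rw [norm_sq_state, ENNReal.ofReal_tsum_of_nonneg (fun _ => sq_nonneg _) (summable_sq u)]

/-- Distribution function bound from the `ℓ¹ → ℓ^∞` and `ℓ² → ℓ²` bounds. -/
theorem count_norm_gt_le (hM : 0 < M)
    (hT : ∀ u : State, (Summable fun x => ‖u x‖) → ∀ x, ‖T u x‖ ≤ M * l1 u) (hK : 0 < K)
    (hw : ∀ x, 0 ≤ w x) (hws : Summable fun x => w x ^ 6) (hA : 0 < ∑' x, w x ^ 6)
    (hf : ∀ x, ‖f x‖ ≤ K * w x ^ 5) {l : ℝ} (hl : 0 < l) :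
    Measure.count {x : ℤ | l < ‖T f x‖} * ENNReal.ofReal (l ^ 5) ≤
      ∑' x, (Set.Iic (2 * M * K * ∑' x, w x ^ 6)).indicator
        (fun _ => ENNReal.ofReal (4 * l ^ 3 * (K ^ 2 * w x ^ 10))) (l * w x) := by
  set A := ∑' x, w x ^ 6 with hAdef
  -- The cut depends on the level `l`. Off `s`, `f` is at most `l w⁶ / (2MA)`, so that part has `ℓ¹`
  -- norm at most `l/(2M)` and image at most `l/2`. Where `‖T f‖ > l` the other part must therefore
  -- contribute at least `l/2`, and Chebyshev's inequality in `ℓ²` counts these sites.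
  set s : Set ℤ := {x | l * w x ≤ 2 * M * K * A} with hs
  set f₂ := restrict s f with hf₂
  set f₁ := restrict sᶜ f with hf₁
  have hsum : f = f₁ + f₂ := by
    refine lp.ext (funext fun x => ?_)
    change f x = sᶜ.indicator f x + s.indicator f x
    rw [Set.indicator_compl_add_self_apply]
  have hΛ : 0 < 2 * M * K * A := by positivity
  have hb : ∀ x, ‖f₁ x‖ ≤ l / (2 * M * A) * w x ^ 6 := by
    intro x
    by_cases hx : x ∈ s
    · have : f₁ x = 0 := Set.indicator_of_notMem (by simpa using hx) _
      rw [this, norm_zero]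
      have := hw x
      positivity
    · have e : f₁ x = f x := Set.indicator_of_mem (by simpa using hx) _
      rw [e]
      refine (hf x).trans ?_
      have h1 : 2 * M * K * A < l * w x := not_le.1 hx
      rw [div_mul_eq_mul_div, le_div_iff₀ (by positivity)]
      have := mul_le_mul_of_nonneg_right h1.le (pow_nonneg (hw x) 5)
      calc K * w x ^ 5 * (2 * M * A) = 2 * M * K * A * w x ^ 5 := by ring
        _ ≤ l * w x * w x ^ 5 := this
        _ = l * w x ^ 6 := by ring
  have hs1 : Summable fun x => ‖f₁ x‖ :=
    (hws.mul_left _).of_nonneg_of_le (fun _ => norm_nonneg _) hb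
  have hl1 : l1 f₁ ≤ l / (2 * M) := by
    refine (hs1.tsum_le_tsum hb (hws.mul_left _)).trans (le_of_eq ?_)
    rw [tsum_mul_left, ← hAdef]
    field_simp
  have hinf : ∀ x, ‖T f₁ x‖ ≤ l / 2 := fun x => by
    refine (hT f₁ hs1 x).trans ((mul_le_mul_of_nonneg_left hl1 hM.le).trans (le_of_eq ?_))
    field_simp
  have hpt : ∀ x ∈ {x : ℤ | l < ‖T f x‖}, 1 ≤ 4 / l ^ 2 * ‖T f₂ x‖ ^ 2 := by
    intro x hx
    have hx : l < ‖T f x‖ := hx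
    have e : T f x = T f₁ x + T f₂ x := by
      rw [hsum, map_add]
      rfl
    have h1 := norm_add_le (T f₁ x) (T f₂ x)
    rw [← e] at h1
    have h2 := hinf x
    have h3 : l / 2 ≤ ‖T f₂ x‖ := by linarith
    rw [div_mul_eq_mul_div, le_div_iff₀ (by positivity)]
    nlinarith
  have hcount : Measure.count {x : ℤ | l < ‖T f x‖} ≤ ENNReal.ofReal (4 / l ^ 2 * ‖f₂‖ ^ 2) := by
    rw [← T.norm_map f₂, ENNReal.ofReal_mul (by positivity), ← tsum_ofReal_norm_sq,
      ← ENNReal.tsum_mul_left, ← lintegral_indicator_one MeasurableSet.of_discrete,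
      lintegral_count]
    refine ENNReal.tsum_le_tsum fun x => ?_
    by_cases hx : x ∈ {x : ℤ | l < ‖T f x‖}
    · rw [Set.indicator_of_mem hx, ← ENNReal.ofReal_mul (by positivity)]
      simpa using hpt x hx
    · rw [Set.indicator_of_notMem hx]
      exact zero_le
  calc Measure.count {x : ℤ | l < ‖T f x‖} * ENNReal.ofReal (l ^ 5)
      ≤ ENNReal.ofReal (4 / l ^ 2 * ‖f₂‖ ^ 2) * ENNReal.ofReal (l ^ 5) := by gcongr
    _ = ENNReal.ofReal (4 * l ^ 3) * ENNReal.ofReal (‖f₂‖ ^ 2) := by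
        rw [← ENNReal.ofReal_mul (by positivity), ← ENNReal.ofReal_mul (by positivity)]
        congr 1
        field_simp
    _ = ∑' x, ENNReal.ofReal (4 * l ^ 3) * ENNReal.ofReal (‖f₂ x‖ ^ 2) := by
        rw [← tsum_ofReal_norm_sq, ENNReal.tsum_mul_left]
    _ ≤ _ := by
        refine ENNReal.tsum_le_tsum fun x => ?_
        by_cases hx : x ∈ s
        · have e : f₂ x = f x := Set.indicator_of_mem hx _
          rw [Set.indicator_of_mem (show l * w x ∈ Set.Iic (2 * M * K * A) from hx), e,
            ← ENNReal.ofReal_mul (by positivity)]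
          refine ENNReal.ofReal_le_ofReal (mul_le_mul_of_nonneg_left ?_ (by positivity))
          calc ‖f x‖ ^ 2 ≤ (K * w x ^ 5) ^ 2 := pow_le_pow_left₀ (norm_nonneg _) (hf x) 2
            _ = K ^ 2 * w x ^ 10 := by ring
        · have e : f₂ x = 0 := Set.indicator_of_notMem hx _
          rw [e]
          simp

/-- The integrand lives on `l ≤ L / v`, where `∫ 4l³ = (L / v)⁴` lowers `v^{10}` to `v⁶`. -/
theorem lintegral_level_le {L v : ℝ} (hL : 0 < L) (hv : 0 ≤ v) :
    ∫⁻ l in Set.Ioi (0 : ℝ), (Set.Iic L).indicator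
      (fun _ => ENNReal.ofReal (4 * l ^ 3 * (K ^ 2 * v ^ 10))) (l * v)
      ≤ ENNReal.ofReal (K ^ 2 * L ^ 4 * v ^ 6) := by
  rcases hv.eq_or_lt with rfl | hv
  · simp
  have hB : 0 < L / v := div_pos hL hv
  calc ∫⁻ l in Set.Ioi (0 : ℝ), (Set.Iic L).indicator
          (fun _ => ENNReal.ofReal (4 * l ^ 3 * (K ^ 2 * v ^ 10))) (l * v)
      ≤ ∫⁻ l in Set.Ioi (0 : ℝ), (Set.Ioc 0 (L / v)).indicator
        (fun l => ENNReal.ofReal (4 * l ^ 3 * (K ^ 2 * v ^ 10))) l := by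
        refine setLIntegral_mono' measurableSet_Ioi fun l hl => ?_
        by_cases h : l * v ≤ L
        · rw [Set.indicator_of_mem (show l * v ∈ Set.Iic L from h),
            Set.indicator_of_mem (show l ∈ Set.Ioc 0 (L / v) from ⟨hl, (le_div_iff₀ hv).2 h⟩)]
        · rw [Set.indicator_of_notMem (show l * v ∉ Set.Iic L from h)]
          exact zero_le
    _ ≤ ∫⁻ l, (Set.Ioc 0 (L / v)).indicator
        (fun l => ENNReal.ofReal (4 * l ^ 3 * (K ^ 2 * v ^ 10))) l := setLIntegral_le_lintegral _ _
    _ = ∫⁻ l in Set.Ioc 0 (L / v), ENNReal.ofReal (4 * l ^ 3 * (K ^ 2 * v ^ 10)) :=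
        lintegral_indicator measurableSet_Ioc _
    _ = ENNReal.ofReal (∫ l in Set.Ioc 0 (L / v), 4 * l ^ 3 * (K ^ 2 * v ^ 10)) := by
        rw [ofReal_integral_eq_lintegral_ofReal]
        · exact (Continuous.integrableOn_Icc (by fun_prop)).mono_set Set.Ioc_subset_Icc_self
        · refine (ae_restrict_mem measurableSet_Ioc).mono fun l hl => ?_
          have := hl.1
          simp only [Pi.zero_apply]
          positivity
    _ ≤ ENNReal.ofReal (K ^ 2 * L ^ 4 * v ^ 6) := by
        refine ENNReal.ofReal_le_ofReal (le_of_eq ?_)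
        rw [← intervalIntegral.integral_of_le hB.le]
        have : (fun l : ℝ => 4 * l ^ 3 * (K ^ 2 * v ^ 10))
            = fun l => (4 * (K ^ 2 * v ^ 10)) * l ^ 3 := by
          ext; ring
        rw [this, intervalIntegral.integral_const_mul, integral_pow]
        norm_num [div_pow]
        field_simp

/-- Real interpolation between `ℓ¹ → ℓ^∞` and `ℓ² → ℓ²`, at the point `ℓ^{6/5} → ℓ⁶`. -/
theorem tsum_norm_pow_six_le (hM : 0 < M)
    (hT : ∀ u : State, (Summable fun x => ‖u x‖) → ∀ x, ‖T u x‖ ≤ M * l1 u) (hK : 0 < K)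
    (hw : ∀ x, 0 ≤ w x) (hws : Summable fun x => w x ^ 6)
    (hf : ∀ x, ‖f x‖ ≤ K * w x ^ 5) :
    ∑' x, ‖T f x‖ ^ 6 ≤ 96 * K ^ 6 * M ^ 4 * (∑' x, w x ^ 6) ^ 5 := by
  have hA0 : 0 ≤ ∑' x, w x ^ 6 := tsum_nonneg fun x => pow_nonneg (hw x) 6
  rcases hA0.eq_or_lt with hA | hA
  · have hz := (hasSum_zero_iff_of_nonneg fun x => pow_nonneg (hw x) 6).1 (hA ▸ hws.hasSum)
    have hf0 : f = 0 := by
      refine lp.ext (funext fun x => ?_)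
      have h1 : w x = 0 := by simpa using congrFun hz x
      have h2 := hf x
      rw [h1] at h2
      simpa using h2
    rw [← hA, hf0, map_zero]
    simp
  have hA0 : 0 ≤ ∑' x, w x ^ 6 := hA.le
  have hs6 : Summable fun x => ‖T f x‖ ^ 6 := summable_norm_pow_add_two (T f) 4
  rw [← ENNReal.ofReal_le_ofReal_iff (by positivity),
    ENNReal.ofReal_tsum_of_nonneg (fun _ => by positivity) hs6,
    ← lintegral_count (fun x : ℤ => ENNReal.ofReal (‖T f x‖ ^ 6))]
  -- The layer-cake formula. Summing the level integrals with `L = 2MKA`, `A = ∑ w⁶`, gives `6 K² L⁴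
  -- A`, whence the constant `96 = 6 · 2⁴`.
  have hlc := lintegral_rpow_eq_lintegral_meas_lt_mul (Measure.count : Measure ℤ)
    (f := fun x => ‖T f x‖) (Filter.Eventually.of_forall fun _ => norm_nonneg _)
    (measurable_of_countable _).aemeasurable (p := 6) (by norm_num)
  have e6 : ∀ y : ℝ, y ^ (6 : ℝ) = y ^ 6 := fun y => by
    rw [← Real.rpow_natCast]; norm_num
  have e5 : ∀ y : ℝ, y ^ (6 - 1 : ℝ) = y ^ 5 := fun y => by
    rw [← Real.rpow_natCast]; norm_num
  simp only [e6, e5] at hlc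
  rw [hlc]
  set L := 2 * M * K * ∑' x, w x ^ 6 with hLdef
  have hL : 0 < L := by positivity
  have hmeas : ∀ x : ℤ, AEMeasurable (fun l : ℝ => (Set.Iic L).indicator
      (fun _ => ENNReal.ofReal (4 * l ^ 3 * (K ^ 2 * w x ^ 10))) (l * w x))
      (volume.restrict (Set.Ioi 0)) := by
    intro x
    have hset : MeasurableSet {l : ℝ | l * w x ∈ Set.Iic L} :=
      measurableSet_Iic.preimage (measurable_id.mul_const _)
    have : (fun l : ℝ => (Set.Iic L).indicator
      (fun _ => ENNReal.ofReal (4 * l ^ 3 * (K ^ 2 * w x ^ 10))) (l * w x))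
      = {l : ℝ | l * w x ∈ Set.Iic L}.indicator
        (fun l => ENNReal.ofReal (4 * l ^ 3 * (K ^ 2 * w x ^ 10))) := rfl
    rw [this]
    exact ((by fun_prop : Measurable fun l : ℝ =>
      ENNReal.ofReal (4 * l ^ 3 * (K ^ 2 * w x ^ 10))).indicator hset).aemeasurable
  calc ENNReal.ofReal 6 * ∫⁻ l in Set.Ioi (0 : ℝ),
        Measure.count {x : ℤ | l < ‖T f x‖} * ENNReal.ofReal (l ^ 5)
      ≤ ENNReal.ofReal 6 * ∫⁻ l in Set.Ioi (0 : ℝ), ∑' x, (Set.Iic L).indicator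
        (fun _ => ENNReal.ofReal (4 * l ^ 3 * (K ^ 2 * w x ^ 10))) (l * w x) := by
        refine mul_le_mul_right (setLIntegral_mono' measurableSet_Ioi fun l hl => ?_) _
        exact count_norm_gt_le hM hT hK hw hws hA hf hl
    _ = ENNReal.ofReal 6 * ∑' x, ∫⁻ l in Set.Ioi (0 : ℝ), (Set.Iic L).indicator
        (fun _ => ENNReal.ofReal (4 * l ^ 3 * (K ^ 2 * w x ^ 10))) (l * w x) := by
        rw [lintegral_tsum hmeas]
    _ ≤ ENNReal.ofReal 6 * ∑' x, ENNReal.ofReal (K ^ 2 * L ^ 4 * w x ^ 6) := by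
        refine mul_le_mul_right (ENNReal.tsum_le_tsum fun x => lintegral_level_le hL (hw x)) _
    _ = ENNReal.ofReal (96 * K ^ 6 * M ^ 4 * (∑' x, w x ^ 6) ^ 5) := by
        rw [← ENNReal.ofReal_tsum_of_nonneg (fun x => by have := hw x; positivity)
          (hws.mul_left _), tsum_mul_left, ← ENNReal.ofReal_mul (by norm_num), hLdef]
        congr 1
        ring

end Interpolation

/-! ### The `ℓ⁶` norm and its decay rate -/

/-- The `ℓ⁶` norm of a state. -/
def n6 (u : State) : ℝ :=
  ‖(⟨u, (lp.memℓp u).of_exponent_ge (by norm_num)⟩ : lp (fun _ : ℤ => Spin) 6)‖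

theorem n6_nonneg (u : State) : 0 ≤ n6 u := lp.norm_nonneg' _

theorem n6_add_le (u v : State) : n6 (u + v) ≤ n6 u + n6 v := by
  have : Fact ((1 : ENNReal) ≤ 6) := ⟨by norm_num⟩
  exact norm_add_le
    (⟨u, (lp.memℓp u).of_exponent_ge (by norm_num)⟩ : lp (fun _ : ℤ => Spin) 6)
    ⟨v, (lp.memℓp v).of_exponent_ge (by norm_num)⟩

theorem n6_zero : n6 0 = 0 := lp.norm_zero

theorem n6_sum_le {ι : Type*} (s : Finset ι) (f : ι → State) :
    n6 (∑ i ∈ s, f i) ≤ ∑ i ∈ s, n6 (f i) :=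
  Finset.le_sum_of_subadditive n6 n6_zero.le n6_add_le s f

theorem summable_norm_pow_six (u : State) : Summable fun x => ‖u x‖ ^ 6 :=
  summable_norm_pow_add_two u 4

theorem n6_pow_six (u : State) : n6 u ^ 6 = ∑' x, ‖u x‖ ^ 6 := by
  have h := lp.norm_rpow_eq_tsum (p := 6) (by norm_num)
    (⟨u, (lp.memℓp u).of_exponent_ge (by norm_num)⟩ : lp (fun _ : ℤ => Spin) 6)
  have e : ∀ y : ℝ, y ^ (ENNReal.toReal 6) = y ^ 6 := fun y => by
    rw [← Real.rpow_natCast]; norm_num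
  simp only [e] at h
  exact h

theorem norm_apply_le_n6 (u : State) (x : ℤ) : ‖u x‖ ≤ n6 u :=
  lp.norm_apply_le_norm (by norm_num)
    (⟨u, (lp.memℓp u).of_exponent_ge (by norm_num)⟩ : lp (fun _ : ℤ => Spin) 6) x

/-- Sixth roots are avoided by using `1 + P` in place of `P^{1/6}`. -/
theorem le_of_pow_six_le {x z P : ℝ} (hz : 0 ≤ z) (hP : 0 ≤ P) (h : x ^ 6 ≤ P * z ^ 6) :
    x ≤ (1 + P) * z := by
  refine le_of_pow_le_pow_left₀ (n := 6) (by norm_num) (by positivity) (h.trans ?_)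
  rw [mul_pow]
  refine mul_le_mul_of_nonneg_right ?_ (by positivity)
  have : (1 + P) ^ 1 ≤ (1 + P) ^ 6 := pow_le_pow_right₀ (by linarith) (by norm_num)
  linarith

theorem norm_le_l1 {u : State} (hu : Summable fun x => ‖u x‖) : ‖u‖ ≤ l1 u := by
  refine le_of_sq_le_sq ?_ (l1_nonneg u)
  rw [norm_sq_state, sq, l1, ← tsum_mul_left]
  refine (summable_sq u).tsum_le_tsum (fun x => ?_) (hu.mul_left _)
  rw [sq]
  exact mul_le_mul_of_nonneg_right (hu.le_tsum x fun _ _ => norm_nonneg _) (norm_nonneg _)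

/-- The decay rate `(1 + t)^{-2/9}` of the `ℓ⁶` norm. -/
def dec6 (t : ℕ) : ℝ := (1 + t : ℝ) ^ (-(2 / 9) : ℝ)

theorem dec6_pos (t : ℕ) : 0 < dec6 t := Real.rpow_pos_of_pos (by positivity) _

theorem dec6_zero : dec6 0 = 1 := by simp [dec6]

theorem dec6_anti {s t : ℕ} (h : s ≤ t) : dec6 t ≤ dec6 s :=
  Real.rpow_le_rpow_of_nonpos (by positivity) (by gcongr) (by norm_num)

/-- The sixth power of the `ℓ⁶` norm carries four factors of the sup-norm rate, which is where the
exponent `2/9 = (4/6)(1/3)` comes from. -/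
theorem dec_pow_four (t : ℕ) : dec t ^ 4 = dec6 t ^ 6 := by
  have h : (0 : ℝ) ≤ 1 + t := by positivity
  rw [dec, dec6, ← Real.rpow_natCast, ← Real.rpow_natCast, ← Real.rpow_mul h, ← Real.rpow_mul h]
  norm_num

/-- The exponent is `5 · 2/9 = 10/9 > 1`: a quintic nonlinearity is just strong enough for
integrability in time. -/
theorem summable_dec6_pow : Summable fun t => dec6 t ^ 5 := by
  have h := (summable_nat_add_iff 1).2
    (Real.summable_nat_rpow (p := -(10 / 9)).2 (by norm_num))
  refine h.congr fun t => ?_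
  have h : (0 : ℝ) ≤ 1 + t := by positivity
  rw [dec6, ← Real.rpow_natCast, ← Real.rpow_mul h]
  push_cast
  rw [add_comm (t : ℝ) 1]
  norm_num

theorem dec6_le_two_mul {n t : ℕ} (h : t ≤ 2 * n + 1) : dec6 n ≤ 2 * dec6 t := by
  have h' : (t : ℝ) ≤ 2 * n + 1 := by exact_mod_cast h
  calc dec6 n ≤ ((1 + t : ℝ) / 2) ^ (-(2 / 9) : ℝ) :=
        Real.rpow_le_rpow_of_nonpos (by positivity) (by linarith) (by norm_num)
    _ = (1 / 2 : ℝ) ^ (-(2 / 9) : ℝ) * dec6 t := by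
        rw [dec6, ← Real.mul_rpow (by norm_num) (by positivity)]; congr 1; ring
    _ ≤ 2 * dec6 t := by
        refine mul_le_mul_of_nonneg_right ?_ (dec6_pos _).le
        calc (1 / 2 : ℝ) ^ (-(2 / 9) : ℝ) ≤ (1 / 2 : ℝ) ^ (-1 : ℝ) :=
              Real.rpow_le_rpow_of_exponent_ge (by norm_num) (by norm_num) (by norm_num)
          _ = 2 := by rw [Real.rpow_neg_one]; norm_num

/-- The larger of `s` and `t - s` is at least `t/2`, so one factor at that time is comparable to
`dec6 t`; what remains is bounded by a fifth power at the smaller time. -/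
theorem dec6_mul_pow_le {s t : ℕ} (h : s ≤ t) :
    dec6 (t - s) * dec6 s ^ 5 ≤ 2 * dec6 t * (dec6 (t - s) ^ 5 + dec6 s ^ 5) := by
  have ha := dec6_pos (t - s)
  have hb := dec6_pos s
  have ht := dec6_pos t
  rcases le_total s (t - s) with hs | hs
  · have h1 : dec6 (t - s) ≤ 2 * dec6 t := dec6_le_two_mul (by omega)
    calc dec6 (t - s) * dec6 s ^ 5 ≤ 2 * dec6 t * dec6 s ^ 5 := by gcongr
      _ ≤ _ := by
        refine mul_le_mul_of_nonneg_left ?_ (by positivity)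
        exact le_add_of_nonneg_left (by positivity)
  · have h1 : dec6 s ≤ 2 * dec6 t := dec6_le_two_mul (by omega)
    have h2 := dec6_anti hs
    calc dec6 (t - s) * dec6 s ^ 5 = dec6 s * (dec6 (t - s) * dec6 s ^ 4) := by ring
      _ ≤ 2 * dec6 t * (dec6 (t - s) * dec6 (t - s) ^ 4) := by gcongr
      _ = 2 * dec6 t * dec6 (t - s) ^ 5 := by ring
      _ ≤ _ := by
        refine mul_le_mul_of_nonneg_left ?_ (by positivity)
        exact le_add_of_nonneg_right (by positivity)

theorem exists_sum_dec6_le : ∃ B : ℝ, 0 < B ∧ ∀ t : ℕ,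
    ∑ s ∈ Finset.range t, dec6 (t - s) * dec6 s ^ 5 ≤ B * dec6 t := by
  have hS := summable_dec6_pow
  have h0 : ∀ t, 0 ≤ dec6 t ^ 5 := fun t => pow_nonneg (dec6_pos t).le 5
  have hS0 : 0 ≤ ∑' t, dec6 t ^ 5 := tsum_nonneg h0
  refine ⟨4 * ∑' t, dec6 t ^ 5 + 1, by linarith, fun t => ?_⟩
  have ht := dec6_pos t
  have h1 : ∑ s ∈ Finset.range t, dec6 s ^ 5 ≤ ∑' t, dec6 t ^ 5 :=
    hS.sum_le_tsum _ fun t _ => h0 t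
  have h2 : ∑ s ∈ Finset.range t, dec6 (t - s) ^ 5 ≤ ∑' t, dec6 t ^ 5 := by
    -- The reflection turns `t - s` into `s + 1`, where `dec6` is no larger than at `s`.
    rw [← Finset.sum_range_reflect]
    refine le_trans (Finset.sum_le_sum fun s hs => ?_) h1
    have := Finset.mem_range.1 hs
    exact pow_le_pow_left₀ (dec6_pos _).le (dec6_anti (by omega)) 5
  calc ∑ s ∈ Finset.range t, dec6 (t - s) * dec6 s ^ 5
      ≤ ∑ s ∈ Finset.range t, 2 * dec6 t * (dec6 (t - s) ^ 5 + dec6 s ^ 5) :=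
        Finset.sum_le_sum fun s hs => dec6_mul_pow_le (Finset.mem_range.1 hs).le
    _ = 2 * dec6 t * (∑ s ∈ Finset.range t, dec6 (t - s) ^ 5
        + ∑ s ∈ Finset.range t, dec6 s ^ 5) := by
        rw [← Finset.mul_sum, Finset.sum_add_distrib]
    _ ≤ _ := by nlinarith

section

variable {a b : ℂ} {C₀ : U2}

/-- The `ℓ¹` bound comes from `‖·‖⁶ ≤ sup⁴ · ‖·‖²` and unitarity; the other is the real
interpolation estimate with `w = ‖v‖`. The pointwise condition `‖f‖ ≤ K‖v‖⁵` stands in for an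
`ℓ^{6/5}` norm of `f`. -/
theorem exists_n6_U0_pow_le (hab : ‖a‖ ^ 2 + ‖b‖ ^ 2 = 1) (h0 : 0 < ‖a‖) (h1 : ‖a‖ < 1)
    (hC₀ : (C₀ : Matrix (Fin 2) (Fin 2) ℂ) = !![a, b; -conj b, conj a]) :
    ∃ C : ℝ, 0 < C ∧
      (∀ (t : ℕ) (u : State), (Summable fun x => ‖u x‖) →
        n6 ((U0 C₀ ^ t) u) ≤ C * dec6 t * l1 u) ∧
      ∀ (K : ℝ), 0 < K → ∀ (t : ℕ) (f v : State), (∀ x, ‖f x‖ ≤ K * ‖v x‖ ^ 5) →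
        n6 ((U0 C₀ ^ t) f) ≤ C * K * dec6 t * n6 v ^ 5 := by
  obtain ⟨C, hC, h⟩ := exists_norm_U0_pow_apply_le hab h0 h1 hC₀
  refine ⟨1 + 96 * C ^ 4, by positivity, fun t u hu => ?_, fun K hK t f v hf => ?_⟩
  · have hl := l1_nonneg u
    have hd := dec6_pos t
    rw [mul_assoc]
    refine le_of_pow_six_le (by positivity) (by positivity) ?_
    rw [n6_pow_six]
    have hpt : ∀ x, ‖(U0 C₀ ^ t) u x‖ ^ 6 ≤ (C * dec t * l1 u) ^ 4 * ‖(U0 C₀ ^ t) u x‖ ^ 2 := by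
      intro x
      rw [show (6 : ℕ) = 4 + 2 from rfl, pow_add]
      exact mul_le_mul_of_nonneg_right (pow_le_pow_left₀ (norm_nonneg _) (h t u hu x) 4)
        (sq_nonneg _)
    calc ∑' x, ‖(U0 C₀ ^ t) u x‖ ^ 6
        ≤ ∑' x, (C * dec t * l1 u) ^ 4 * ‖(U0 C₀ ^ t) u x‖ ^ 2 :=
          (summable_norm_pow_six _).tsum_le_tsum hpt ((summable_sq _).mul_left _)
      _ = (C * dec t * l1 u) ^ 4 * ‖u‖ ^ 2 := by
          rw [tsum_mul_left, ← norm_sq_state, LinearIsometryEquiv.norm_map]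
      _ ≤ (C * dec t * l1 u) ^ 4 * l1 u ^ 2 := by
          have := dec_pos t
          gcongr
          exact norm_le_l1 hu
      _ = C ^ 4 * (dec6 t * l1 u) ^ 6 := by
          rw [mul_pow (dec6 t), ← dec_pow_four]
          ring
      _ ≤ _ := by
          refine mul_le_mul_of_nonneg_right ?_ (by positivity)
          have : 0 < C ^ 4 := by positivity
          linarith
  · have hl := n6_nonneg v
    have hd := dec6_pos t
    rw [show (1 + 96 * C ^ 4) * K * dec6 t * n6 v ^ 5 = (1 + 96 * C ^ 4) * (K * dec6 t * n6 v ^ 5)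
      by ring]
    refine le_of_pow_six_le (by positivity) (by positivity) ?_
    rw [n6_pow_six]
    refine (tsum_norm_pow_six_le (M := C * dec t) (mul_pos hC (dec_pos t))
      (fun u hu x => h t u hu x) hK (fun x => norm_nonneg (v x)) (summable_norm_pow_six v) hf).trans (le_of_eq ?_)
    rw [← n6_pow_six, mul_pow _ (n6 v ^ 5), mul_pow K, ← dec_pow_four]
    ring

end

/-! ### The nonlinear part of the coin and Duhamel's formula -/

/-- The nonlinear part `N(v) = (C_N(|v₁|², |v₂|²) - 1) v` of the coin at one site. -/
def nlSpin (CN : ℝ → ℝ → U2) (v : Spin) : Spin := act (CN (‖v 0‖ ^ 2) (‖v 1‖ ^ 2)) v - v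

/-- The nonlinear part `Ĉ_N - 1` of the coin. -/
def nl (CN : ℝ → ℝ → U2) (u : State) : State := coin CN u - u

section

variable {C₀ : U2} {CN : ℝ → ℝ → U2} {K L ρ : ℝ}

theorem nl_apply (u : State) (x : ℤ) : nl CN u x = nlSpin CN (u x) := rfl

theorem step_eq (u : State) : step C₀ CN u = U0 C₀ (u + nl CN u) := by
  rw [nl, add_sub_cancel, U0_eq, step]
  congr 1
  refine lp.ext (funext fun x => ?_)
  exact (act_act _ _ _).symm

theorem evol_succ (t : ℕ) (u : State) :
    evol C₀ CN (t + 1) u = U0 C₀ (evol C₀ CN t u + nl CN (evol C₀ CN t u)) := by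
  rw [evol, Function.iterate_succ_apply', step_eq]
  rfl

theorem U0_pow_succ (t : ℕ) (u : State) : (U0 C₀ ^ (t + 1)) u = U0 C₀ ((U0 C₀ ^ t) u) := by
  rw [pow_succ']
  rfl

/-- Duhamel's formula. -/
theorem evol_eq (t : ℕ) (u : State) : evol C₀ CN t u = (U0 C₀ ^ t) u
    + ∑ s ∈ Finset.range t, (U0 C₀ ^ (t - s)) (nl CN (evol C₀ CN s u)) := by
  induction t with
  | zero => simp [evol]
  | succ t ih =>
    rw [evol_succ, map_add]
    conv_lhs => rw [ih]
    rw [map_add, map_sum, ← U0_pow_succ, Finset.sum_range_succ, add_assoc]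
    congr 2
    · refine Finset.sum_congr rfl fun s hs => ?_
      have := Finset.mem_range.1 hs
      rw [← U0_pow_succ, show t + 1 - s = t - s + 1 by omega]
    · rw [← ih, show t + 1 - t = 1 by omega, pow_one]

theorem norm_le_of_apply_sq_le {f : State} {g : ℤ → ℝ} {P : ℝ} (hP : 0 ≤ P)
    (hf : ∀ x, ‖f x‖ ^ 2 ≤ g x) (hg : Summable g) (hgP : ∑' x, g x ≤ P ^ 2) : ‖f‖ ≤ P := by
  refine le_of_sq_le_sq ?_ hP
  rw [norm_sq_state]
  exact ((summable_sq f).tsum_le_tsum hf hg).trans hgP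

/-- The square of a quintic term is `‖u x‖^{10}`; four of the factors are bounded by the sup norm,
hence by `n6 u`, and the other six are summed. -/
theorem norm_nl_le (hK : 0 < K) (hN : ∀ v, ‖nlSpin CN v‖ ≤ K * ‖v‖ ^ 5) (u : State) :
    ‖nl CN u‖ ≤ K * n6 u ^ 5 := by
  have hn := n6_nonneg u
  refine norm_le_of_apply_sq_le (g := fun x => K ^ 2 * n6 u ^ 4 * ‖u x‖ ^ 6) (by positivity)
    (fun x => ?_) ((summable_norm_pow_six u).mul_left _) (le_of_eq ?_)
  · rw [nl_apply]
    have h4 := pow_le_pow_left₀ (norm_nonneg _) (norm_apply_le_n6 u x) 4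
    calc ‖nlSpin CN (u x)‖ ^ 2 ≤ (K * ‖u x‖ ^ 5) ^ 2 := pow_le_pow_left₀ (norm_nonneg _) (hN _) 2
      _ = K ^ 2 * ‖u x‖ ^ 4 * ‖u x‖ ^ 6 := by ring
      _ ≤ K ^ 2 * n6 u ^ 4 * ‖u x‖ ^ 6 := by gcongr
  · rw [tsum_mul_left, ← n6_pow_six]
    ring

theorem pow_four_mul_sq_le {p q : ℝ} (hp : 0 ≤ p) (hq : 0 ≤ q) :
    p ^ 4 * q ^ 2 ≤ p ^ 6 + q ^ 6 := by
  rcases le_total p q with h | h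
  · calc p ^ 4 * q ^ 2 ≤ q ^ 4 * q ^ 2 := by gcongr
      _ ≤ p ^ 6 + q ^ 6 := by nlinarith [pow_nonneg hp 6]
  · calc p ^ 4 * q ^ 2 ≤ p ^ 4 * p ^ 2 := by gcongr
      _ ≤ p ^ 6 + q ^ 6 := by nlinarith [pow_nonneg hq 6]

theorem add_pow_six_le {p q : ℝ} (hp : 0 ≤ p) (hq : 0 ≤ q) :
    (p + q) ^ 6 ≤ 64 * (p ^ 6 + q ^ 6) := by
  rcases le_total p q with h | h
  · calc (p + q) ^ 6 ≤ (q + q) ^ 6 := by gcongr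
      _ ≤ _ := by nlinarith [pow_nonneg hp 6]
  · calc (p + q) ^ 6 ≤ (p + p) ^ 6 := by gcongr
      _ ≤ _ := by nlinarith [pow_nonneg hq 6]

/-- Hölder's inequality by hand: four of the eight factors `‖u x‖ + ‖v x‖` in the square are bounded
by `2P`, and the rest, rescaled by `P` and `Q`, is split by the crude Young inequality `p⁴q² ≤ p⁶ +
q⁶`. -/
theorem norm_nl_sub_le {P Q : ℝ} (hL : 0 ≤ L)
    (hN : ∀ v w, ‖v‖ ≤ ρ → ‖w‖ ≤ ρ →
      ‖nlSpin CN v - nlSpin CN w‖ ≤ L * (‖v‖ + ‖w‖) ^ 4 * ‖v - w‖)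
    {u v : State} (hP : 0 < P) (hPρ : P ≤ ρ) (hQ : 0 < Q) (hu : n6 u ≤ P) (hv : n6 v ≤ P)
    (huv : n6 (u - v) ≤ Q) : ‖nl CN u - nl CN v‖ ≤ 50 * L * P ^ 4 * Q := by
  set g : ℤ → ℝ := fun x => ‖u x‖ + ‖v x‖ with hg
  set h : ℤ → ℝ := fun x => ‖(u - v) x‖ with hh
  have hux := fun x => (norm_apply_le_n6 u x).trans hu
  have hvx := fun x => (norm_apply_le_n6 v x).trans hv
  have hg0 : ∀ x, 0 ≤ g x := fun x => by positivity
  have hsum : Summable fun x => L ^ 2 * (2 * P) ^ 4 * (P ^ 4 * Q ^ 2)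
      * (64 * (P⁻¹) ^ 6 * (‖u x‖ ^ 6 + ‖v x‖ ^ 6) + (Q⁻¹) ^ 6 * ‖(u - v) x‖ ^ 6) :=
    ((((summable_norm_pow_six u).add (summable_norm_pow_six v)).mul_left _).add
      ((summable_norm_pow_six (u - v)).mul_left _)).mul_left _
  refine norm_le_of_apply_sq_le (by positivity) (fun x => ?_) hsum ?_
  · have e : (nl CN u - nl CN v) x = nlSpin CN (u x) - nlSpin CN (v x) := rfl
    have h1 : ‖nlSpin CN (u x) - nlSpin CN (v x)‖ ≤ L * g x ^ 4 * h x :=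
      hN (u x) (v x) ((hux x).trans hPρ) ((hvx x).trans hPρ)
    have h2 : g x ≤ 2 * P := by
      have := hux x
      have := hvx x
      simp only [hg]
      linarith
    rw [e]
    have h3 := pow_four_mul_sq_le (p := P⁻¹ * g x) (q := Q⁻¹ * h x)
      (mul_nonneg (by positivity) (hg0 x)) (by positivity)
    have h4 := add_pow_six_le (norm_nonneg (u x)) (norm_nonneg (v x))
    have h5 := hg0 x
    calc ‖nlSpin CN (u x) - nlSpin CN (v x)‖ ^ 2 ≤ (L * g x ^ 4 * h x) ^ 2 :=
          pow_le_pow_left₀ (norm_nonneg _) h1 2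
      _ = L ^ 2 * g x ^ 4 * (g x ^ 4 * h x ^ 2) := by ring
      _ ≤ L ^ 2 * (2 * P) ^ 4 * (g x ^ 4 * h x ^ 2) := by gcongr
      _ = L ^ 2 * (2 * P) ^ 4 * (P ^ 4 * Q ^ 2) * ((P⁻¹ * g x) ^ 4 * (Q⁻¹ * h x) ^ 2) := by
          field_simp
      _ ≤ L ^ 2 * (2 * P) ^ 4 * (P ^ 4 * Q ^ 2) * ((P⁻¹ * g x) ^ 6 + (Q⁻¹ * h x) ^ 6) := by
          gcongr
      _ ≤ _ := by
          refine mul_le_mul_of_nonneg_left ?_ (by positivity)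
          rw [mul_pow, mul_pow]
          refine add_le_add ?_ le_rfl
          calc P⁻¹ ^ 6 * g x ^ 6 ≤ P⁻¹ ^ 6 * (64 * (‖u x‖ ^ 6 + ‖v x‖ ^ 6)) := by gcongr
            _ = _ := by ring
  · have s := (summable_norm_pow_six u).add (summable_norm_pow_six v)
    rw [tsum_mul_left, (s.mul_left _).tsum_add ((summable_norm_pow_six (u - v)).mul_left _),
      tsum_mul_left, tsum_mul_left, (summable_norm_pow_six u).tsum_add (summable_norm_pow_six v),
      ← n6_pow_six, ← n6_pow_six, ← n6_pow_six]
    have e1 := pow_le_pow_left₀ (n6_nonneg u) hu 6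
    have e2 := pow_le_pow_left₀ (n6_nonneg v) hv 6
    have e3 := pow_le_pow_left₀ (n6_nonneg (u - v)) huv 6
    calc _ ≤ L ^ 2 * (2 * P) ^ 4 * (P ^ 4 * Q ^ 2)
          * (64 * P⁻¹ ^ 6 * (P ^ 6 + P ^ 6) + Q⁻¹ ^ 6 * Q ^ 6) := by gcongr
      -- `2064 = 16 (64 · 2 + 1)`, rounded up to `2500 = 50²` to have an exact square root.
      _ = 2064 * (L ^ 2 * P ^ 8 * Q ^ 2) := by
          field_simp
          ring
      _ ≤ 2500 * (L ^ 2 * P ^ 8 * Q ^ 2) := by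
          refine mul_le_mul_of_nonneg_right (by norm_num) (by positivity)
      _ = _ := by ring

end

/-! ### Small data: global decay, convergence of the series and telescoping -/

section

variable {C₀ : U2} {CN : ℝ → ℝ → U2} {K L ρ C B : ℝ}

/-- The Duhamel integral inherits the decay rate of its input. -/
theorem n6_duhamel_le (hK : 0 < K) (hN : ∀ v, ‖nlSpin CN v‖ ≤ K * ‖v‖ ^ 5) (hC : 0 < C)
    (h2 : ∀ (K : ℝ), 0 < K → ∀ (t : ℕ) (f v : State), (∀ x, ‖f x‖ ≤ K * ‖v x‖ ^ 5) →
        n6 ((U0 C₀ ^ t) f) ≤ C * K * dec6 t * n6 v ^ 5)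
    (hB : ∀ t : ℕ, ∑ s ∈ Finset.range t, dec6 (t - s) * dec6 s ^ 5 ≤ B * dec6 t)
    {η : ℝ} (hη : 0 < η) {t : ℕ} {v : ℕ → State} (hv : ∀ s < t, n6 (v s) ≤ η * dec6 s) :
    n6 (∑ s ∈ Finset.range t, (U0 C₀ ^ (t - s)) (nl CN (v s))) ≤ C * K * η ^ 5 * (B * dec6 t) := by
  refine (n6_sum_le (Finset.range t)
    fun s => (U0 C₀ ^ (t - s)) (nl CN (v s))).trans ?_
  calc ∑ s ∈ Finset.range t, n6 ((U0 C₀ ^ (t - s)) (nl CN (v s)))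
      ≤ ∑ s ∈ Finset.range t, C * K * η ^ 5 * (dec6 (t - s) * dec6 s ^ 5) := by
        refine Finset.sum_le_sum fun s hs => ?_
        have h5 := pow_le_pow_left₀ (n6_nonneg _) (hv s (Finset.mem_range.1 hs)) 5
        have hd := dec6_pos (t - s)
        have hx : ∀ x, ‖nl CN (v s) x‖ ≤ K * ‖v s x‖ ^ 5 := fun x => hN (v s x)
        refine (h2 K hK (t - s) (nl CN (v s)) (v s) hx).trans ?_
        calc C * K * dec6 (t - s) * n6 (v s) ^ 5
            ≤ C * K * dec6 (t - s) * (η * dec6 s) ^ 5 :=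
              mul_le_mul_of_nonneg_left h5 (by positivity)
          _ = _ := by ring
    _ ≤ _ := by
        rw [← Finset.mul_sum]
        exact mul_le_mul_of_nonneg_left (hB t) (by positivity)

/-- Bootstrap: the linear part uses up one half of the constant `2Cε`, and by `hsmall` the Duhamel
sum, which involves only earlier times, fits into the other half. -/
theorem n6_evol_le (hK : 0 < K) (hN : ∀ v, ‖nlSpin CN v‖ ≤ K * ‖v‖ ^ 5) (hC : 0 < C)
    (h1 : ∀ (t : ℕ) (u : State), (Summable fun x => ‖u x‖) →
        n6 ((U0 C₀ ^ t) u) ≤ C * dec6 t * l1 u)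
    (h2 : ∀ (K : ℝ), 0 < K → ∀ (t : ℕ) (f v : State), (∀ x, ‖f x‖ ≤ K * ‖v x‖ ^ 5) →
        n6 ((U0 C₀ ^ t) f) ≤ C * K * dec6 t * n6 v ^ 5)
    (hB : ∀ t : ℕ, ∑ s ∈ Finset.range t, dec6 (t - s) * dec6 s ^ 5 ≤ B * dec6 t)
    {ε : ℝ} (hε : 0 < ε) (hsmall : C * K * (2 * C * ε) ^ 5 * B ≤ C * ε)
    {u : State} (hu : Summable fun x => ‖u x‖) (hul : l1 u ≤ ε) (t : ℕ) :
    n6 (evol C₀ CN t u) ≤ 2 * C * ε * dec6 t := by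
  induction t using Nat.strong_induction_on with
  | _ t ih =>
    have hd := dec6_pos t
    rw [evol_eq]
    refine (n6_add_le _ _).trans ?_
    have e1 : n6 ((U0 C₀ ^ t) u) ≤ C * dec6 t * ε :=
      (h1 t u hu).trans (mul_le_mul_of_nonneg_left hul (by positivity))
    have e2 := n6_duhamel_le hK hN hC h2 hB (η := 2 * C * ε) (by positivity) ih
    have e3 := mul_le_mul_of_nonneg_right hsmall hd.le
    linarith

theorem waveTerm_eq (u : State) (t : ℕ) :
    waveTerm C₀ CN u t = ((U0 C₀)⁻¹ ^ t) (nl CN (evol C₀ CN t u)) := rfl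

theorem U0_inv_U0 (u : State) : (U0 C₀)⁻¹ (U0 C₀ u) = u := (U0 C₀).symm_apply_apply u

theorem inv_pow_succ (t : ℕ) (u : State) :
    ((U0 C₀)⁻¹ ^ (t + 1)) u = (U0 C₀)⁻¹ (((U0 C₀)⁻¹ ^ t) u) := by
  rw [pow_succ']
  rfl

theorem dec6_pow_summable_mul (c : ℝ) : Summable fun t => c * dec6 t ^ 5 :=
  summable_dec6_pow.mul_left c

/-- Convergence of the series defining `W^*`, and its leading term, for small `ℓ¹` data. -/
theorem exists_wave_bounds {a b : ℂ} (hab : ‖a‖ ^ 2 + ‖b‖ ^ 2 = 1) (h0 : 0 < ‖a‖) (h1 : ‖a‖ < 1)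
    (hC₀ : (C₀ : Matrix (Fin 2) (Fin 2) ℂ) = !![a, b; -conj b, conj a])
    (hK : 0 < K) (hN : ∀ v, ‖nlSpin CN v‖ ≤ K * ‖v‖ ^ 5) (hL : 0 ≤ L) (hρ : 0 < ρ)
    (hNL : ∀ v w, ‖v‖ ≤ ρ → ‖w‖ ≤ ρ →
      ‖nlSpin CN v - nlSpin CN w‖ ≤ L * (‖v‖ + ‖w‖) ^ 4 * ‖v - w‖) :
    ∃ δ D : ℝ, 0 < δ ∧ 0 ≤ D ∧ ∀ (ε : ℝ) (u : State), 0 < ε → ε < δ → (Summable fun x => ‖u x‖) →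
      l1 u ≤ ε → Summable (waveTerm C₀ CN u) ∧
        Summable (fun t => ((U0 C₀)⁻¹ ^ t) (nl CN ((U0 C₀ ^ t) u))) ∧
        ‖∑' t, waveTerm C₀ CN u t - ∑' t, ((U0 C₀)⁻¹ ^ t) (nl CN ((U0 C₀ ^ t) u))‖
          ≤ D * ε ^ 9 := by
  obtain ⟨C, hC, h1, h2⟩ := exists_n6_U0_pow_le hab h0 h1 hC₀
  obtain ⟨B, hB0, hB⟩ := exists_sum_dec6_le
  set S := ∑' t, dec6 t ^ 5 with hS
  have hS0 : 0 ≤ S := tsum_nonneg fun t => pow_nonneg (dec6_pos t).le 5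
  -- The three bounds on `ε` give `ε⁵ ≤ ε²`, close the bootstrap, and keep all values within the
  -- radius `ρ` of the Lipschitz estimate.
  refine ⟨min 1 (min (C / (C * K * (2 * C) ^ 5 * B)) (ρ / (2 * C))),
    50 * L * (2 * C) ^ 4 * (C * K * (2 * C) ^ 5 * B) * S, by positivity, by positivity,
    fun ε u hε hεδ hu hul => ?_⟩
  have hε1 : ε < 1 := hεδ.trans_le (min_le_left _ _)
  have hε2 : ε * (C * K * (2 * C) ^ 5 * B) < C :=
    (lt_div_iff₀ (by positivity)).1
      (hεδ.trans_le ((min_le_right _ _).trans (min_le_left _ _)))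
  have hε3 : ε * (2 * C) < ρ :=
    (lt_div_iff₀ (by positivity)).1
      (hεδ.trans_le ((min_le_right _ _).trans (min_le_right _ _)))
  have hsmall : C * K * (2 * C * ε) ^ 5 * B ≤ C * ε := by
    have e4 : ε ^ 5 ≤ ε ^ 2 := pow_le_pow_of_le_one hε.le hε1.le (by norm_num)
    calc C * K * (2 * C * ε) ^ 5 * B = C * K * (2 * C) ^ 5 * B * ε ^ 5 := by ring
      _ ≤ C * K * (2 * C) ^ 5 * B * ε ^ 2 := by gcongr
      _ = ε * (C * K * (2 * C) ^ 5 * B) * ε := by ring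
      _ ≤ C * ε := mul_le_mul_of_nonneg_right hε2.le hε.le
  have hev := n6_evol_le hK hN hC h1 h2 hB hε hsmall hu hul
  have hlin : ∀ t, n6 ((U0 C₀ ^ t) u) ≤ 2 * C * ε * dec6 t := fun t => by
    have hd := dec6_pos t
    refine (h1 t u hu).trans ?_
    calc C * dec6 t * l1 u ≤ C * dec6 t * ε := by gcongr
      _ ≤ 2 * (C * dec6 t * ε) := le_mul_of_one_le_left (by positivity) (by norm_num)
      _ = _ := by ring
  have hnorm : ∀ (v : State) (t : ℕ), n6 v ≤ 2 * C * ε * dec6 t →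
      ‖((U0 C₀)⁻¹ ^ t) (nl CN v)‖ ≤ K * (2 * C * ε) ^ 5 * dec6 t ^ 5 := fun v t hv => by
    rw [LinearIsometryEquiv.norm_map]
    refine (norm_nl_le hK hN v).trans ?_
    rw [mul_assoc, ← mul_pow]
    exact mul_le_mul_of_nonneg_left (pow_le_pow_left₀ (n6_nonneg v) hv 5) hK.le
  have s1 : Summable (waveTerm C₀ CN u) :=
    Summable.of_norm_bounded (dec6_pow_summable_mul _) fun t => hnorm _ t (hev t)
  have s2 : Summable (fun t => ((U0 C₀)⁻¹ ^ t) (nl CN ((U0 C₀ ^ t) u))) :=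
    Summable.of_norm_bounded (dec6_pow_summable_mul _) fun t => hnorm _ t (hlin t)
  refine ⟨s1, s2, ?_⟩
  rw [← s1.tsum_sub s2]
  -- Four factors of size `ε · dec6 t` multiply a difference of size `ε⁵ · dec6 t`: this yields `ε⁹`
  -- and a summable fifth power.
  have hterm : ∀ t, ‖waveTerm C₀ CN u t - ((U0 C₀)⁻¹ ^ t) (nl CN ((U0 C₀ ^ t) u))‖
      ≤ 50 * L * (2 * C) ^ 4 * (C * K * (2 * C) ^ 5 * B) * ε ^ 9 * dec6 t ^ 5 := fun t => by
    have hd := dec6_pos t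
    rw [waveTerm_eq, ← map_sub, LinearIsometryEquiv.norm_map]
    have hdiff : n6 (evol C₀ CN t u - (U0 C₀ ^ t) u) ≤ C * K * (2 * C * ε) ^ 5 * (B * dec6 t) := by
      rw [evol_eq, add_sub_cancel_left]
      exact n6_duhamel_le hK hN hC h2 hB (by positivity) fun s _ => hev s
    have hPρ : 2 * C * ε * dec6 t ≤ ρ := by
      have : dec6 t ≤ 1 := dec6_zero ▸ dec6_anti (Nat.zero_le t)
      calc 2 * C * ε * dec6 t ≤ 2 * C * ε := mul_le_of_le_one_right (by positivity) this
        _ ≤ ρ := by linarith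
    refine (norm_nl_sub_le hL hNL (P := 2 * C * ε * dec6 t) (by positivity) hPρ (by positivity)
      (hev t) (hlin t) hdiff).trans (le_of_eq ?_)
    ring
  refine (tsum_of_norm_bounded (dec6_pow_summable_mul _).hasSum hterm).trans (le_of_eq ?_)
  rw [tsum_mul_left]
  ring

/-- In `W^* - U₀⁻¹ W^* U₀` the identity terms cancel, and the linearised series for `u` and `U₀ u`
differ by an index shift, so that only the `t = 0` term survives. -/
theorem exists_norm_Wstar_sub_le {a b : ℂ} (hab : ‖a‖ ^ 2 + ‖b‖ ^ 2 = 1) (h0 : 0 < ‖a‖)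
    (h1 : ‖a‖ < 1) (hC₀ : (C₀ : Matrix (Fin 2) (Fin 2) ℂ) = !![a, b; -conj b, conj a])
    (hK : 0 < K) (hN : ∀ v, ‖nlSpin CN v‖ ≤ K * ‖v‖ ^ 5) (hL : 0 ≤ L) (hρ : 0 < ρ)
    (hNL : ∀ v w, ‖v‖ ≤ ρ → ‖w‖ ≤ ρ →
      ‖nlSpin CN v - nlSpin CN w‖ ≤ L * (‖v‖ + ‖w‖) ^ 4 * ‖v - w‖) :
    ∃ δ D : ℝ, 0 < δ ∧ 0 ≤ D ∧ ∀ (ε : ℝ) (u : State), 0 < ε → ε < δ → (Summable fun x => ‖u x‖) →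
      l1 u ≤ ε → Summable (waveTerm C₀ CN u) ∧
        ‖Wstar C₀ CN u - (U0 C₀)⁻¹ (Wstar C₀ CN (U0 C₀ u)) - nl CN u‖ ≤ D * ε ^ 9 := by
  obtain ⟨δ, D, hδ, hD, h⟩ := exists_wave_bounds (CN := CN) hab h0 h1 hC₀ hK hN hL hρ hNL
  -- `U₀` at most doubles the `ℓ¹` norm; this halves `δ` and gives `513 = 1 + 2⁹`.
  refine ⟨δ / 2, 513 * D, by linarith, by linarith, fun ε u hε hεδ hu hul => ?_⟩
  obtain ⟨s1, s2, hb⟩ := h ε u hε (by linarith) hu hul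
  obtain ⟨s1', s2', hb'⟩ := h (2 * ε) (U0 C₀ u) (by linarith) (by linarith) (summable_norm_U0 hu)
    ((l1_U0_le hu).trans (by linarith))
  refine ⟨s1, ?_⟩
  set V : ℕ → State := fun t => ((U0 C₀)⁻¹ ^ t) (nl CN ((U0 C₀ ^ t) u)) with hV
  set V' : ℕ → State := fun t => ((U0 C₀)⁻¹ ^ t) (nl CN ((U0 C₀ ^ t) (U0 C₀ u))) with hV'
  have htel : ∑' t, V t = nl CN u + (U0 C₀)⁻¹ (∑' t, V' t) := by
    rw [s2.tsum_eq_zero_add]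
    congr 1
    have hm : (U0 C₀)⁻¹ (∑' t, V' t) = ∑' t, (U0 C₀)⁻¹ (V' t) :=
      (((U0 C₀)⁻¹).toContinuousLinearEquiv.map_tsum)
    rw [hm]
    refine tsum_congr fun t => ?_
    simp only [hV, hV']
    rw [inv_pow_succ, pow_succ (U0 C₀)]
    rfl
  have e : Wstar C₀ CN u - (U0 C₀)⁻¹ (Wstar C₀ CN (U0 C₀ u)) - nl CN u
      = (∑' t, waveTerm C₀ CN u t - ∑' t, V t)
        - (U0 C₀)⁻¹ (∑' t, waveTerm C₀ CN (U0 C₀ u) t - ∑' t, V' t) := by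
    rw [Wstar, Wstar, map_add, map_sub, U0_inv_U0, htel]
    abel
  rw [e]
  refine (norm_sub_le _ _).trans ?_
  rw [LinearIsometryEquiv.norm_map]
  refine (add_le_add hb hb').trans (le_of_eq ?_)
  ring

end

/-! ### Regularity of the nonlinear coin near the origin -/

theorem norm_toLp_mulVec_le (A : Matrix (Fin 2) (Fin 2) ℂ) (v : Spin) :
    ‖(WithLp.toLp 2 (A.mulVec v.ofLp) : Spin)‖ ≤ ‖A‖ * ‖v‖ :=
  Matrix.l2_opNorm_mulVec A v

theorem matrix_norm_le_of_entry_le {A : Matrix (Fin 2) (Fin 2) ℂ} {c : ℝ}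
    (h : ∀ i j, ‖A i j‖ ≤ c) : ‖A‖ ≤ 4 * c := by
  have hc : 0 ≤ c := (norm_nonneg _).trans (h 0 0)
  rw [Matrix.l2_opNorm_def]
  refine ContinuousLinearMap.opNorm_le_bound _ (by positivity) fun v => ?_
  have hcoord : ∀ i, ‖A i 0 * v 0 + A i 1 * v 1‖ ≤ 2 * c * ‖v‖ := fun i => by
    refine (norm_add_le _ _).trans ?_
    rw [norm_mul, norm_mul]
    have h1 := mul_le_mul (h i 0) (norm_coord_le v 0) (norm_nonneg _) hc
    have h2 := mul_le_mul (h i 1) (norm_coord_le v 1) (norm_nonneg _) hc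
    linarith
  have e : ∀ i, (A.mulVec v.ofLp) i = A i 0 * v 0 + A i 1 * v 1 := fun i => by
    rw [Matrix.mulVec, dotProduct, Fin.sum_univ_two]
  refine (norm_spin_le (WithLp.toLp 2 (A.mulVec v.ofLp))).trans ?_
  change ‖(A.mulVec v.ofLp) 0‖ + ‖(A.mulVec v.ofLp) 1‖ ≤ _
  rw [e, e]
  linarith [hcoord 0, hcoord 1]

section

variable {CN Ct : ℝ → ℝ → U2}

theorem nlSpin_eq
    (hCN : ∀ s₁ s₂ : ℝ, 0 ≤ s₁ → 0 ≤ s₂ → CN s₁ s₂ = Ct (s₁ ^ 2) (s₂ ^ 2)) (v : Spin) :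
    nlSpin CN v = WithLp.toLp 2
      (((Ct (‖v 0‖ ^ 4) (‖v 1‖ ^ 4) : Matrix (Fin 2) (Fin 2) ℂ) - 1).mulVec v.ofLp) := by
  rw [nlSpin, hCN _ _ (sq_nonneg _) (sq_nonneg _), ← pow_mul, ← pow_mul, act, Matrix.sub_mulVec,
    Matrix.one_mulVec]
  rfl

theorem exists_norm_nlSpin_le
    (hCN : ∀ s₁ s₂ : ℝ, 0 ≤ s₁ → 0 ≤ s₂ → CN s₁ s₂ = Ct (s₁ ^ 2) (s₂ ^ 2))
    (hbound : ∃ K : ℝ, ∀ s₁ s₂ : ℝ,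
      ‖(Ct s₁ s₂ : Matrix (Fin 2) (Fin 2) ℂ) - 1‖ ≤ K * (|s₁| + |s₂|)) :
    ∃ K : ℝ, 0 < K ∧ (∀ v : Spin, ‖(Ct (‖v 0‖ ^ 4) (‖v 1‖ ^ 4) : Matrix (Fin 2) (Fin 2) ℂ) - 1‖
      ≤ K * ‖v‖ ^ 4) ∧ ∀ v, ‖nlSpin CN v‖ ≤ K * ‖v‖ ^ 5 := by
  obtain ⟨K, hK⟩ := hbound
  have hm : ∀ v : Spin, ‖(Ct (‖v 0‖ ^ 4) (‖v 1‖ ^ 4) : Matrix (Fin 2) (Fin 2) ℂ) - 1‖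
      ≤ (2 * |K| + 1) * ‖v‖ ^ 4 := fun v => by
    refine (hK _ _).trans ?_
    rw [abs_of_nonneg (by positivity), abs_of_nonneg (by positivity)]
    have h0 := pow_le_pow_left₀ (norm_nonneg _) (norm_coord_le v 0) 4
    have h1 := pow_le_pow_left₀ (norm_nonneg _) (norm_coord_le v 1) 4
    have h2 : 0 ≤ ‖v‖ ^ 4 := by positivity
    calc K * (‖v 0‖ ^ 4 + ‖v 1‖ ^ 4) ≤ |K| * (‖v‖ ^ 4 + ‖v‖ ^ 4) := by
          refine mul_le_mul (le_abs_self K) (add_le_add h0 h1) (by positivity) (abs_nonneg K)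
      _ ≤ _ := by linarith
  refine ⟨2 * |K| + 1, by positivity, hm, fun v => ?_⟩
  rw [nlSpin_eq hCN]
  refine (norm_toLp_mulVec_le _ _).trans ?_
  rw [pow_succ ‖v‖ 4, ← mul_assoc]
  exact mul_le_mul_of_nonneg_right (hm v) (norm_nonneg _)

theorem abs_pow_four_sub_le (p q : ℂ) :
    |‖p‖ ^ 4 - ‖q‖ ^ 4| ≤ (‖p‖ + ‖q‖) ^ 3 * ‖p - q‖ := by
  have hp := norm_nonneg p
  have hq := norm_nonneg q
  rw [show ‖p‖ ^ 4 - ‖q‖ ^ 4 = ((‖p‖ + ‖q‖) * (‖p‖ ^ 2 + ‖q‖ ^ 2)) * (‖p‖ - ‖q‖) by ring, abs_mul,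
    abs_of_nonneg (by positivity)]
  refine mul_le_mul ?_ (abs_norm_sub_norm_le p q) (abs_nonneg _) (by positivity)
  rw [pow_succ' _ 2]
  refine mul_le_mul_of_nonneg_left ?_ (by positivity)
  nlinarith

/-- With `G` the value of `C̃_N`, `N(v) - N(w) = (G_v - 1)(v - w) + (G_v - G_w)w`. The first term is
quartic times the difference; the second uses that a `C¹` map is Lipschitz near `0`, together with
the factorisation of `|v_i|⁴ - |w_i|⁴`. -/
theorem exists_nlSpin_lipschitz
    (hCN : ∀ s₁ s₂ : ℝ, 0 ≤ s₁ → 0 ≤ s₂ → CN s₁ s₂ = Ct (s₁ ^ 2) (s₂ ^ 2))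
    (hCt : ContDiff ℝ 2 (fun s : ℝ × ℝ => (Ct s.1 s.2 : Matrix (Fin 2) (Fin 2) ℂ)))
    (hbound : ∃ K : ℝ, ∀ s₁ s₂ : ℝ,
      ‖(Ct s₁ s₂ : Matrix (Fin 2) (Fin 2) ℂ) - 1‖ ≤ K * (|s₁| + |s₂|)) :
    ∃ L ρ : ℝ, 0 ≤ L ∧ 0 < ρ ∧ ∀ v w, ‖v‖ ≤ ρ → ‖w‖ ≤ ρ →
      ‖nlSpin CN v - nlSpin CN w‖ ≤ L * (‖v‖ + ‖w‖) ^ 4 * ‖v - w‖ := by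
  obtain ⟨K, hK, hm, -⟩ := exists_norm_nlSpin_le hCN hbound
  obtain ⟨L, s, hs, hL⟩ :=
    ((hCt.of_le (by norm_num : (1 : WithTop ℕ∞) ≤ 2)).contDiffAt
      (x := (0 : ℝ × ℝ))).exists_lipschitzOnWith
  obtain ⟨r, hr, hrs⟩ := Metric.mem_nhds_iff.1 hs
  refine ⟨K + L, min 1 (r / 2), by positivity, by positivity, fun v w hv hw => ?_⟩
  have hmem : ∀ v : Spin, ‖v‖ ≤ min 1 (r / 2) → ((‖v 0‖ ^ 4, ‖v 1‖ ^ 4) : ℝ × ℝ) ∈ s := by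
    intro v hv
    apply hrs
    have h1 : ‖v‖ ≤ 1 := hv.trans (min_le_left _ _)
    have h2 : ‖v‖ ≤ r / 2 := hv.trans (min_le_right _ _)
    have h3 : ∀ i, ‖v i‖ ^ 4 < r := fun i => by
      have hi := norm_coord_le v i
      calc ‖v i‖ ^ 4 ≤ ‖v i‖ := pow_le_of_le_one (norm_nonneg _) (hi.trans h1) (by norm_num)
        _ < r := by linarith
    rw [mem_ball_zero_iff, Prod.norm_mk]
    refine max_lt ?_ ?_ <;> rw [Real.norm_of_nonneg (by positivity)]
    exacts [h3 0, h3 1]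
  have hlip := hL.norm_sub_le (hmem v hv) (hmem w hw)
  simp only [Prod.mk_sub_mk, Prod.norm_mk, Real.norm_eq_abs] at hlip
  set Gv := (Ct (‖v 0‖ ^ 4) (‖v 1‖ ^ 4) : Matrix (Fin 2) (Fin 2) ℂ)
  set Gw := (Ct (‖w 0‖ ^ 4) (‖w 1‖ ^ 4) : Matrix (Fin 2) (Fin 2) ℂ)
  have hd : ∀ i, |‖v i‖ ^ 4 - ‖w i‖ ^ 4| ≤ (‖v‖ + ‖w‖) ^ 3 * ‖v - w‖ := fun i => by
    refine (abs_pow_four_sub_le _ _).trans ?_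
    have := norm_coord_le v i
    have := norm_coord_le w i
    have : ‖v i - w i‖ ≤ ‖v - w‖ := norm_coord_le (v - w) i
    gcongr
  have hG : ‖Gv - Gw‖ ≤ L * ((‖v‖ + ‖w‖) ^ 3 * ‖v - w‖) :=
    hlip.trans (mul_le_mul_of_nonneg_left (max_le (hd 0) (hd 1)) L.2)
  have e : nlSpin CN v - nlSpin CN w = WithLp.toLp 2 ((Gv - 1).mulVec (v - w).ofLp)
      + WithLp.toLp 2 ((Gv - Gw).mulVec w.ofLp) := by
    rw [nlSpin_eq hCN, nlSpin_eq hCN, ← WithLp.toLp_add, ← WithLp.toLp_sub]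
    congr 1
    rw [WithLp.ofLp_sub, Matrix.mulVec_sub]
    simp only [Matrix.sub_mulVec, Matrix.one_mulVec]
    abel
  rw [e]
  refine (norm_add_le _ _).trans ((add_le_add ((norm_toLp_mulVec_le _ _).trans
    (mul_le_mul_of_nonneg_right (hm v) (norm_nonneg _))) ((norm_toLp_mulVec_le _ _).trans
    (mul_le_mul_of_nonneg_right hG (norm_nonneg _)))).trans ?_)
  have hv0 := norm_nonneg v
  have hw0 := norm_nonneg w
  have h1 : ‖v‖ ≤ ‖v‖ + ‖w‖ := by linarith
  have h2 : ‖w‖ ≤ ‖v‖ + ‖w‖ := by linarith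
  calc K * ‖v‖ ^ 4 * ‖v - w‖ + L * ((‖v‖ + ‖w‖) ^ 3 * ‖v - w‖) * ‖w‖
      ≤ K * (‖v‖ + ‖w‖) ^ 4 * ‖v - w‖ + L * ((‖v‖ + ‖w‖) ^ 3 * ‖v - w‖) * (‖v‖ + ‖w‖) := by
        gcongr
    _ = _ := by ring

end

/-- Second order Taylor estimate at the origin. -/
theorem exists_norm_taylor_le {E F : Type*} [NormedAddCommGroup E] [NormedSpace ℝ E]
    [NormedAddCommGroup F] [NormedSpace ℝ F] {G : E → F} (hG : ContDiff ℝ 2 G) :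
    ∃ C r : ℝ, 0 ≤ C ∧ 0 < r ∧ ∀ s, ‖s‖ < r → ‖G s - G 0 - fderiv ℝ G 0 s‖ ≤ C * ‖s‖ ^ 2 := by
  have h1 : ContDiff ℝ 1 (fderiv ℝ G) := hG.fderiv_right (by norm_num)
  obtain ⟨L, s, hs, hL⟩ := (h1.contDiffAt (x := (0 : E))).exists_lipschitzOnWith
  obtain ⟨r, hr, hrs⟩ := Metric.mem_nhds_iff.1 hs
  refine ⟨L, r, L.2, hr, fun x hx => ?_⟩
  have hd : Differentiable ℝ G := hG.differentiable (by norm_num)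
  have hmem : ∀ y ∈ Metric.closedBall (0 : E) ‖x‖, y ∈ s := fun y hy =>
    hrs (mem_ball_zero_iff.2 ((mem_closedBall_zero_iff.1 hy).trans_lt hx))
  -- Mean value inequality on the ball of radius `‖x‖`, where the derivative stays within `L‖x‖` of
  -- its value at `0`.
  have key := Convex.norm_image_sub_le_of_norm_hasFDerivWithin_le'
    (s := Metric.closedBall (0 : E) ‖x‖) (C := L * ‖x‖) (x := 0) (y := x)
    (φ := fderiv ℝ G 0) (f := G) (f' := fderiv ℝ G)
    (fun y _ => (hd y).hasFDerivAt.hasFDerivWithinAt)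
    (fun y hy => by
      have := hL.norm_sub_le (hmem y hy) (hmem 0 (by simp))
      rw [sub_zero] at this
      exact this.trans (mul_le_mul_of_nonneg_left (mem_closedBall_zero_iff.1 hy) L.2))
    (convex_closedBall _ _) (by simp) (by simp)
  rw [sub_zero] at key
  refine key.trans (le_of_eq ?_)
  ring

/-! ### The input states and the expansion of the scattering data -/

section Datum

theorem datum_apply_of_ne (i : Fin 2) (l : ℝ) {x : ℤ} (hx : x ≠ 0) : datum i l x = 0 := by
  have h : ∀ j, delta j 0 x = 0 := fun j => lp.single_apply_ne _ _ _ hx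
  change (l : ℂ) ^ 2 • delta i 0 x + (l : ℂ) ^ 3 • delta (1 - i) 0 x = 0
  rw [h, h, smul_zero, smul_zero, add_zero]

theorem datum_apply_zero (i : Fin 2) (l : ℝ) : datum i l 0
    = (l : ℂ) ^ 2 • EuclideanSpace.single i (1 : ℂ)
      + (l : ℂ) ^ 3 • EuclideanSpace.single (1 - i) (1 : ℂ) := by
  have h : ∀ j, delta j 0 0 = EuclideanSpace.single j (1 : ℂ) := fun j =>
    lp.single_apply_self _ _ _
  change (l : ℂ) ^ 2 • delta i 0 0 + (l : ℂ) ^ 3 • delta (1 - i) 0 0 = _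
  rw [h, h]

theorem norm_datum_le (i : Fin 2) {l : ℝ} (h0 : 0 < l) (h1 : l ≤ 1) :
    ‖datum i l 0‖ ≤ 2 * l ^ 2 := by
  rw [datum_apply_zero]
  refine (norm_add_le _ _).trans ?_
  rw [norm_smul, norm_smul, norm_pow, norm_pow, Complex.norm_real, Real.norm_of_nonneg h0.le]
  have : l ^ 3 ≤ l ^ 2 := pow_le_pow_of_le_one h0.le h1 (by norm_num)
  simp
  linarith

theorem summable_norm_datum (i : Fin 2) (l : ℝ) : Summable fun x => ‖datum i l x‖ :=
  (hasSum_single 0 fun x hx => by rw [datum_apply_of_ne i l hx, norm_zero]).summable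

theorem l1_datum_le (i : Fin 2) {l : ℝ} (h0 : 0 < l) (h1 : l ≤ 1) :
    l1 (datum i l) ≤ 2 * l ^ 2 := by
  rw [l1, tsum_eq_single 0 fun x hx => by rw [datum_apply_of_ne i l hx, norm_zero]]
  exact norm_datum_le i h0 h1

theorem inner_delta (j : Fin 2) (u : State) : inner ℂ (delta j 0) u = u 0 j := by
  rw [delta, lp.inner_single_left, EuclideanSpace.inner_single_left]
  simp

end Datum

/-- Error bounds for the difference quotient of a function that is affine up to order four. -/
theorem norm_diffQuot_sub_le {f : ℝ → ℂ} {α β : ℂ} {C l₁ l : ℝ} (hl₁ : l₁ ≤ 1)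
    (hf : ∀ l, 0 < l → l < l₁ → ‖f l - (α + l * β)‖ ≤ C * l ^ 4) (hl : 0 < l) (hl2 : 2 * l < l₁) :
    ‖diffQuot f l - β‖ ≤ 18 * C * l ^ 3 ∧ ‖f l - l * diffQuot f l - α‖ ≤ 18 * C * l ^ 3 := by
  have h1 := hf l hl (by linarith)
  have h2 := hf (2 * l) (by linarith) hl2
  have hC : 0 ≤ C * l ^ 4 := (norm_nonneg _).trans h1
  have hC3 : 0 ≤ C * l ^ 3 := by
    have : C * l ^ 3 = C * l ^ 4 / l := by field_simp
    rw [this]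
    positivity
  have h4 : C * l ^ 4 ≤ C * l ^ 3 := by
    rw [pow_succ, ← mul_assoc]
    exact mul_le_of_le_one_right hC3 (by linarith)
  have hl' : (l : ℂ) ≠ 0 := by exact_mod_cast hl.ne'
  have e1 : diffQuot f l - β = (l : ℂ)⁻¹ * ((f (2 * l) - (α + (2 * l : ℝ) * β))
      - (f l - (α + l * β))) := by
    rw [diffQuot]
    push_cast
    field_simp
    ring
  have e2 : f l - l * diffQuot f l - α = (f l - (α + l * β)) - ((f (2 * l) - (α + (2 * l : ℝ) * β))
      - (f l - (α + l * β))) := by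
    rw [diffQuot]
    push_cast
    field_simp
    ring
  -- `17 = 2⁴ + 1`, from the errors at `2l` and at `l`.
  have h3 : ‖(f (2 * l) - (α + (2 * l : ℝ) * β)) - (f l - (α + l * β))‖ ≤ 17 * (C * l ^ 4) := by
    refine (norm_sub_le _ _).trans ((add_le_add h2 h1).trans (le_of_eq ?_))
    ring
  constructor
  · rw [e1, norm_mul, norm_inv, Complex.norm_real, Real.norm_of_nonneg hl.le]
    calc l⁻¹ * _ ≤ l⁻¹ * (17 * (C * l ^ 4)) := mul_le_mul_of_nonneg_left h3 (by positivity)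
      _ = 17 * (C * l ^ 3) := by field_simp
      _ ≤ _ := by linarith
  · rw [e2]
    refine (norm_sub_le _ _).trans ?_
    linarith

/-- The `i`-th standard basis vector of `ℝ × ℝ`. -/
def axis (i : Fin 2) : ℝ × ℝ := if i = 0 then (1, 0) else (0, 1)

section

variable {C₀ : U2} {CN Ct : ℝ → ℝ → U2}

theorem mulVec_datum (M : Matrix (Fin 2) (Fin 2) ℂ) (i j : Fin 2) (l : ℝ) :
    (M.mulVec (datum i l 0).ofLp) j = (l : ℂ) ^ 2 * M j i + (l : ℂ) ^ 3 * M j (1 - i) := by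
  rw [datum_apply_zero]
  fin_cases i <;> simp [Matrix.mulVec, dotProduct] <;> ring

theorem datum_sizes (i : Fin 2) {l : ℝ} (hl : 0 < l) :
    ((‖datum i l 0 0‖ ^ 4, ‖datum i l 0 1‖ ^ 4) : ℝ × ℝ)
      = l ^ 8 • axis i + l ^ 12 • axis (1 - i) := by
  rw [datum_apply_zero]
  fin_cases i <;> simp [axis, abs_of_pos hl, ← pow_mul]

/-- The leading term of the scattering data. -/
theorem exists_norm_nl_datum_le
    (hCN : ∀ s₁ s₂ : ℝ, 0 ≤ s₁ → 0 ≤ s₂ → CN s₁ s₂ = Ct (s₁ ^ 2) (s₂ ^ 2))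
    (hCt : ContDiff ℝ 2 (fun s : ℝ × ℝ => (Ct s.1 s.2 : Matrix (Fin 2) (Fin 2) ℂ)))
    (hCt0 : (Ct 0 0 : Matrix (Fin 2) (Fin 2) ℂ) = 1) :
    ∃ C r : ℝ, 0 < r ∧ ∀ (i j : Fin 2) (l : ℝ), 0 < l → l < r →
      ‖nl CN (datum i l) 0 j - (l : ℂ) ^ 10 *
        (fderiv ℝ (fun s : ℝ × ℝ => (Ct s.1 s.2 : Matrix (Fin 2) (Fin 2) ℂ)) 0 (axis i) j i
        + l * fderiv ℝ (fun s : ℝ × ℝ => (Ct s.1 s.2 : Matrix (Fin 2) (Fin 2) ℂ)) 0 (axis i) j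
          (1 - i))‖ ≤ C * l ^ 14 := by
  set G := fun s : ℝ × ℝ => (Ct s.1 s.2 : Matrix (Fin 2) (Fin 2) ℂ) with hG
  have hG0 : G 0 = 1 := hCt0
  obtain ⟨C, r, hC, hr, hT⟩ := exists_norm_taylor_le hCt
  set N := ‖fderiv ℝ G 0‖ with hN
  have hax : ∀ i, ‖axis i‖ ≤ 1 := fun i => by
    fin_cases i <;> simp [axis]
  refine ⟨2 * (N + 4 * C), min 1 (r / 2), by positivity, fun i j l hl hlr => ?_⟩
  have hl1 : l ≤ 1 := (hlr.trans_le (min_le_left _ _)).le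
  have hl2 : l < r / 2 := hlr.trans_le (min_le_right _ _)
  set s : ℝ × ℝ := l ^ 8 • axis i + l ^ 12 • axis (1 - i) with hs
  have hsn : ‖s‖ ≤ 2 * l ^ 8 := by
    refine (norm_add_le _ _).trans ?_
    rw [norm_smul, norm_smul, Real.norm_of_nonneg (by positivity),
      Real.norm_of_nonneg (by positivity)]
    have h1 : l ^ 12 ≤ l ^ 8 := pow_le_pow_of_le_one hl.le hl1 (by norm_num)
    have h2 := mul_le_of_le_one_right (pow_nonneg hl.le 8) (hax i)
    have h3 := mul_le_of_le_one_right (pow_nonneg hl.le 12) (hax (1 - i))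
    linarith
  have hl8 : l ^ 8 ≤ l := pow_le_of_le_one hl.le hl1 (by norm_num)
  have hTs := hT s (by linarith)
  rw [hG0] at hTs
  set E := G s - 1 - fderiv ℝ G 0 s with hE
  have hEn : ‖E‖ ≤ 4 * C * l ^ 16 := by
    refine hTs.trans ?_
    calc C * ‖s‖ ^ 2 ≤ C * (2 * l ^ 8) ^ 2 := by gcongr
      _ = _ := by ring
  -- `R` collects the derivative in the other direction, of order `l^{12}`, and the Taylor error, of
  -- order `l^{16}`. Applied to a vector of size `2l²` it contributes `l^{14}`.
  set R := (l ^ 12 : ℝ) • fderiv ℝ G 0 (axis (1 - i)) + E with hR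
  have hRn : ‖R‖ ≤ (N + 4 * C) * l ^ 12 := by
    refine (norm_add_le _ _).trans ?_
    rw [norm_smul, Real.norm_of_nonneg (by positivity)]
    have h1 : ‖fderiv ℝ G 0 (axis (1 - i))‖ ≤ N :=
      ((fderiv ℝ G 0).le_opNorm _).trans (mul_le_of_le_one_right (norm_nonneg _) (hax _))
    have h2 : l ^ 16 ≤ l ^ 12 := pow_le_pow_of_le_one hl.le hl1 (by norm_num)
    calc l ^ 12 * ‖fderiv ℝ G 0 (axis (1 - i))‖ + ‖E‖ ≤ l ^ 12 * N + 4 * C * l ^ 12 := by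
          refine add_le_add ?_ (hEn.trans ?_)
          · gcongr
          · gcongr
      _ = _ := by ring
  have hGs : G s - 1 = (l ^ 8 : ℝ) • fderiv ℝ G 0 (axis i) + R := by
    rw [hR, hE, ← add_assoc, ← map_smul, ← map_smul, ← map_add]
    exact (add_sub_cancel _ _).symm
  have hnl : nl CN (datum i l) 0
      = WithLp.toLp 2 ((G s - 1).mulVec (datum i l 0).ofLp) := by
    rw [nl_apply, nlSpin_eq hCN, hs, ← datum_sizes i hl]
  have e : nl CN (datum i l) 0 j - (l : ℂ) ^ 10 *
        (fderiv ℝ G 0 (axis i) j i + l * fderiv ℝ G 0 (axis i) j (1 - i))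
      = (WithLp.toLp 2 (R.mulVec (datum i l 0).ofLp) : Spin) j := by
    rw [hnl, hGs]
    change (((l ^ 8 : ℝ) • fderiv ℝ G 0 (axis i) + R).mulVec (datum i l 0).ofLp) j - _
      = (R.mulVec (datum i l 0).ofLp) j
    rw [Matrix.add_mulVec, Pi.add_apply, mulVec_datum]
    simp only [Matrix.smul_apply, Complex.real_smul]
    push_cast
    ring
  rw [e]
  refine (norm_coord_le _ j).trans ((norm_toLp_mulVec_le R _).trans ?_)
  calc ‖R‖ * ‖datum i l 0‖ ≤ (N + 4 * C) * l ^ 12 * (2 * l ^ 2) :=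
        mul_le_mul hRn (norm_datum_le i hl hl1) (norm_nonneg _) (by positivity)
    _ = _ := by ring

end

theorem hasDerivAt_mul_axis {F : Type*} [NormedAddCommGroup F] [NormedSpace ℝ F] {G : ℝ × ℝ → F}
    (hG : DifferentiableAt ℝ G 0) (v : ℝ × ℝ) :
    HasDerivAt (fun s : ℝ => G (s • v)) (fderiv ℝ G 0 v) 0 := by
  have h : HasDerivAt (fun s : ℝ => s • v) v 0 := by
    simpa using (hasDerivAt_id (0 : ℝ)).smul_const v
  have hG' : HasFDerivAt G (fderiv ℝ G 0) ((0 : ℝ) • v) := by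
    rw [zero_smul]
    exact hG.hasFDerivAt
  exact hG'.comp_hasDerivAt 0 h

end

end NLQW

/-! ### Reconstruction of the partial derivatives -/

open NLQW in
theorem mainTheorem2
    (a b : ℂ) (hab : ‖a‖ ^ 2 + ‖b‖ ^ 2 = 1) (ha₀ : 0 < ‖a‖) (ha₁ : ‖a‖ < 1)
    (C₀ : NLQW.U2)
    (hC₀ : (C₀ : Matrix (Fin 2) (Fin 2) ℂ) = !![a, b; -conj b, conj a])
    (CN Ct : ℝ → ℝ → NLQW.U2)
    (hCN : ∀ s₁ s₂ : ℝ, 0 ≤ s₁ → 0 ≤ s₂ → CN s₁ s₂ = Ct (s₁ ^ 2) (s₂ ^ 2))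
    (hCt : ContDiff ℝ 2 (fun s : ℝ × ℝ => (Ct s.1 s.2 : Matrix (Fin 2) (Fin 2) ℂ)))
    (hbound : ∃ K : ℝ, ∀ s₁ s₂ : ℝ,
      ‖(Ct s₁ s₂ : Matrix (Fin 2) (Fin 2) ℂ) - 1‖ ≤ K * (|s₁| + |s₂|)) :
    -- `W^*` is well defined on a ball of `ℓ¹`
    (∃ δ : ℝ, 0 < δ ∧ ∀ u : NLQW.State, Summable (fun x => ‖u x‖) → ∑' x, ‖u x‖ < δ →
      Summable (NLQW.waveTerm C₀ CN u)) ∧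
    -- the reproducing formulas for the two partial derivatives at the origin
    ∃ l₀ : ℝ, 0 < l₀ ∧ ∃ K : ℝ, ∀ l : ℝ, 0 < l → l < l₀ →
      ‖NLQW.recon₁ (NLQW.scatL C₀ CN) l
          - deriv (fun s : ℝ => (Ct s 0 : Matrix (Fin 2) (Fin 2) ℂ)) 0‖ ≤ K * l ^ 3 ∧
      ‖NLQW.recon₂ (NLQW.scatL C₀ CN) l
          - deriv (fun s : ℝ => (Ct 0 s : Matrix (Fin 2) (Fin 2) ℂ)) 0‖ ≤ K * l ^ 3 := by
  obtain ⟨K, hK, -, hN⟩ := exists_norm_nlSpin_le hCN hbound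
  obtain ⟨L, ρ, hL, hρ, hNL⟩ := exists_nlSpin_lipschitz hCN hCt hbound
  obtain ⟨δ, D, hδ, hD, hW⟩ := exists_norm_Wstar_sub_le hab ha₀ ha₁ hC₀ hK hN hL hρ hNL
  have hCt0 : (Ct 0 0 : Matrix (Fin 2) (Fin 2) ℂ) = 1 := by
    obtain ⟨K, hK⟩ := hbound
    have := hK 0 0
    simp only [abs_zero, add_zero, mul_zero] at this
    exact sub_eq_zero.1 (norm_le_zero_iff.1 this)
  obtain ⟨C, r, hr, hlead⟩ := exists_norm_nl_datum_le hCN hCt hCt0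
  refine ⟨⟨δ, hδ, fun u hu hul => ?_⟩, ?_⟩
  · have hl0 := l1_nonneg u
    have hul : l1 u < δ := hul
    -- The midpoint is positive even when `u = 0`, and lies strictly below `δ`.
    exact (hW ((l1 u + δ) / 2) u (by linarith) (by linarith) hu (by linarith)).1
  set G := fun s : ℝ × ℝ => (Ct s.1 s.2 : Matrix (Fin 2) (Fin 2) ℂ) with hG
  have hGd : DifferentiableAt ℝ G 0 := (hCt.differentiable (by norm_num)) 0
  set A : Fin 2 → Matrix (Fin 2) (Fin 2) ℂ := fun i => fderiv ℝ G 0 (axis i) with hA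
  have hd1 : deriv (fun s : ℝ => (Ct s 0 : Matrix (Fin 2) (Fin 2) ℂ)) 0 = A 0 := by
    have h := (hasDerivAt_mul_axis hGd (axis 0)).deriv
    simpa [axis, hA, hG] using h
  have hd2 : deriv (fun s : ℝ => (Ct 0 s : Matrix (Fin 2) (Fin 2) ℂ)) 0 = A 1 := by
    have h := (hasDerivAt_mul_axis hGd (axis 1)).deriv
    simpa [axis, hA, hG] using h
  -- The datum has `ℓ¹` norm at most `2l² ≤ 2l`, which is below `δ` when `l < δ / 2`.
  set l₁ := min 1 (min r (δ / 2)) with hl₁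
  have hscat : ∀ i j l, 0 < l → l < l₁ →
      ‖scatL C₀ CN i j l - (A i j i + l * A i j (1 - i))‖ ≤ (512 * D + C) * l ^ 4 := by
    intro i j l hl hll
    have hl1 : l < 1 := hll.trans_le (min_le_left _ _)
    have hlr : l < r := hll.trans_le ((min_le_right _ _).trans (min_le_left _ _))
    have hlδ : l < δ / 2 := hll.trans_le ((min_le_right _ _).trans (min_le_right _ _))
    have hsq : l ^ 2 ≤ l := pow_le_of_le_one hl.le hl1.le (by norm_num)
    have h1 := (hW (2 * l ^ 2) (datum i l) (by positivity) (by linarith) (summable_norm_datum i l)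
      (l1_datum_le i hl hl1.le)).2
    set X := Wstar C₀ CN (datum i l) - (U0 C₀)⁻¹ (Wstar C₀ CN (U0 C₀ (datum i l))) with hX
    have h2 := hlead i j l hl hlr
    have h3 : ‖X 0 j - nl CN (datum i l) 0 j‖ ≤ D * (2 * l ^ 2) ^ 9 :=
      (norm_coord_le ((X - nl CN (datum i l)) 0) j).trans
        ((lp.norm_apply_le_norm two_ne_zero _ 0).trans h1)
    have hlc : (l : ℂ) ≠ 0 := by exact_mod_cast hl.ne'
    have e : scatL C₀ CN i j l - (A i j i + l * A i j (1 - i)) = ((l : ℂ) ^ 10)⁻¹ *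
        ((X 0 j - nl CN (datum i l) 0 j) + (nl CN (datum i l) 0 j
          - (l : ℂ) ^ 10 * (A i j i + l * A i j (1 - i)))) := by
      rw [scatL, inner_delta]
      field_simp
      ring
    have h4 : l ^ 18 ≤ l ^ 14 := pow_le_pow_of_le_one hl.le hl1.le (by norm_num)
    rw [e, norm_mul, norm_inv, norm_pow, Complex.norm_real, Real.norm_of_nonneg hl.le]
    calc (l ^ 10)⁻¹ * _ ≤ (l ^ 10)⁻¹ * (D * (2 * l ^ 2) ^ 9 + C * l ^ 14) :=
          mul_le_mul_of_nonneg_left ((norm_add_le _ _).trans (add_le_add h3 h2)) (by positivity)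
      _ = (l ^ 10)⁻¹ * (512 * D * l ^ 18 + C * l ^ 14) := by ring
      _ ≤ (l ^ 10)⁻¹ * (512 * D * l ^ 14 + C * l ^ 14) := by gcongr
      _ = _ := by field_simp
  have hl₁0 : 0 < l₁ := by positivity
  -- The difference quotient evaluates at `2l`, hence `l₁ / 2`; the factor `4` passes from entries
  -- to the operator norm.
  refine ⟨l₁ / 2, by linarith, 4 * (18 * (512 * D + C)), fun l hl hll => ?_⟩
  have hq := fun i j => norm_diffQuot_sub_le (min_le_left _ _) (hscat i j) hl (by linarith)
  rw [hd1, hd2, mul_assoc 4]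
  constructor
  · refine matrix_norm_le_of_entry_le fun j k => ?_
    rw [Matrix.sub_apply]
    fin_cases j <;> fin_cases k
    · exact (hq 0 0).2
    · exact (hq 0 0).1
    · exact (hq 0 1).2
    · exact (hq 0 1).1
  · refine matrix_norm_le_of_entry_le fun j k => ?_
    rw [Matrix.sub_apply]
    fin_cases j <;> fin_cases k
    · exact (hq 1 0).1
    · exact (hq 1 0).2
    · exact (hq 1 1).1
    · exact (hq 1 1).2
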